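/- Let $d,N$ be integers with $1\le d\le N$. Equip $\mathbb{C}^{d\times N}$ with the standard symplectic form $\omega_F(X,Y)=-\operatorname{Im}\operatorname{tr}(Y^*X)$, and let the unitary group $U(d)$ act on it by left multiplication. Identify the space $\mathcal{H}(d)$ of $d\times d$ Hermitian matrices with the dual $\mathfrak{u}(d)^*$ of the Lie algebra of skew-Hermitian matrices through the linear isomorphism $\alpha:\mathcal{H}(d)\to\mathfrak{u}(d)^*$, $\alpha_\xi(\eta)=\tfrac{i}{2}\operatorname{tr}(\eta^*\xi)$. A momentum map for a smooth action of $U(d)$ by diffeomorphisms preserving $\omega$ is a smooth map $\Phi$ into $\mathfrak{u}(d)^*$ such that, for every $\xi\in\mathfrak{u}(d)$, the function $\Phi^\xi(F)=\Phi(F)(\xi)$ and the vector field $X^\xi_F=\frac{d}{dt}\big|_{t=0}\exp(t\xi)\cdot F$ satisfy $\omega(X^\xi,\cdot)=d\Phi^\xi$, and such that $\Phi(A\cdot F)=\operatorname{Ad}^*_A\Phi(F)$ for all $A\in U(d)$, where $(\operatorname{Ad}^*_A\varphi)(\eta)=\varphi(A^*\eta A)$. A regular value of a smooth map is a point of its image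 over which the differential is surjective at every point of the fibre. A matrix $F\in\mathbb{C}^{d\times N}$ with columns $f_1,\dots,f_N$ is an $a$-tight frame ($a>0$) if $\sum_{i}|\langle v,f_i\rangle|^2=a\|v\|^2$ for all $v\in\mathbb{C}^d$; let $\mathcal{F}_{N/d}$ be the set of $N/d$-tight frames. Then the following hold. 1. $\omega$ is a symplectic form, $\alpha$ is an isomorphism, and the action of $U(d)$ on $(\mathbb{C}^{d\times N},\omega)$ is Hamiltonian with momentum map $\Phi:\mathbb{C}^{d\times N}\to\mathcal{H}(d)\cong\mathfrak{u}(d)^*$, $\Phi(F)=-FF^*$. 2. The regular values of $\Phi:\mathbb{C}^{d\times N}\to\mathcal{H}(d)$ are exactly the negative definite matrices in $\mathcal{H}(d)$. 3. $\mathcal{F}_{N/d}=\Phi^{-1}\bigl(-\tfrac{N}{d}\mathbb{I}_d\bigr)$, and $U(d)$ acts freely on this set. Hence $\mathcal{F}_{N/d}/U(d)$ is the symplectic quotient $\mathbb{C}^{d\times N}/\!\!/_{-\frac{N}{d}\mathbb{I}_d}U(d)$, and it carries a natural symplectic structure: $\mathcal{F}_{N/d}$, with inclusion $\iota$, is an embedded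 smooth submanifold of $\mathbb{C}^{d\times N}$ of dimension $2dN-d^2$; the quotient space $\mathcal{F}_{N/d}/U(d)$ is (with the quotient topology) a smooth manifold of dimension $2(dN-d^2)$ for which the projection $q:\mathcal{F}_{N/d}\to\mathcal{F}_{N/d}/U(d)$ is a smooth submersion; and there is a unique symplectic form $\omega_{\mathrm{red}}$ on $\mathcal{F}_{N/d}/U(d)$ with $q^*\omega_{\mathrm{red}}=\iota^*\omega$. -/

import Mathlib

open scoped Matrix Manifold ContDiff ComplexOrder Matrix.Norms.Elementwise

noncomputable section

namespace FrameReduction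

/-! ### Symplectic forms on manifolds -/

section Forms

variable {E : Type*} [NormedAddCommGroup E] [NormedSpace ℝ E]
  {M : Type*} [TopologicalSpace M] [ChartedSpace E M]
  {E' : Type*} [NormedAddCommGroup E'] [NormedSpace ℝ E']
  {M' : Type*} [TopologicalSpace M'] [ChartedSpace E' M']

/-- A (not necessarily smooth) field of alternating bilinear forms on the tangent spaces of a
manifold `M` modelled on `E`. -/
abbrev TwoForm (E : Type*) [NormedAddCommGroup E] [NormedSpace ℝ E]
    (M : Type*) [TopologicalSpace M] [ChartedSpace E M] : Type _ :=
  ∀ p : M, TangentSpace 𝓘(ℝ, E) p [⋀^Fin 2]→L[ℝ] ℝ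

/-- The pullback `f^* σ`, that is `(f^* σ)_p (X, Y) = σ_{f p} (df_p X, df_p Y)`. -/
def TwoForm.pullback (f : M' → M) (σ : TwoForm E M) : TwoForm E' M' :=
  fun p => (σ (f p)).compContinuousLinearMap (mfderiv 𝓘(ℝ, E') 𝓘(ℝ, E) f p)

/-- The expression of `σ` in the chart `e`: the pullback of `σ` along `e⁻¹`, regarded as a form on
(the open subset `e.target` of) the model vector space `E`. -/
def TwoForm.inChart (σ : TwoForm E M) (e : OpenPartialHomeomorph M E) :
    E → E [⋀^Fin 2]→L[ℝ] ℝ :=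
  (σ.pullback (e.symm : E → M) : TwoForm E E)

/-- A symplectic form: a smooth, closed, nondegenerate two-form. Smoothness and closedness are
checked in the charts of the atlas. -/
structure IsSymplecticForm (σ : TwoForm E M) : Prop where
  smooth : ∀ e ∈ atlas E M, ContDiffOn ℝ ∞ (σ.inChart e) e.target
  closed : ∀ e ∈ atlas E M, ∀ x ∈ e.target, extDeriv (σ.inChart e) x = 0
  nondegenerate : ∀ (p : M) (X : TangentSpace 𝓘(ℝ, E) p),
    (∀ Y : TangentSpace 𝓘(ℝ, E) p, σ p ![X, Y] = 0) → X = 0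

/-- Alternating bilinear forms on a vector space. -/
abbrev AltForm (E : Type*) [NormedAddCommGroup E] [NormedSpace ℝ E] : Type _ :=
  E [⋀^Fin 2]→L[ℝ] ℝ

/-- Two-forms on a vector space `E`, regarded as a manifold modelled on itself. -/
abbrev VectorSpaceTwoForm (E : Type*) [NormedAddCommGroup E] [NormedSpace ℝ E] : Type _ :=
  TwoForm E E

end Forms

/-! ### The unitary group, its Lie algebra, and the coadjoint action -/

/-- The unitary group `U(d)`. -/
abbrev U (d : ℕ) := Matrix.unitaryGroup (Fin d) ℂ

/-- The Lie algebra of `U(d)`: skew-Hermitian matrices. -/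
abbrev LieU (d : ℕ) : Submodule ℝ (Matrix (Fin d) (Fin d) ℂ) :=
  skewAdjoint.submodule ℝ (Matrix (Fin d) (Fin d) ℂ)

/-- Hermitian matrices, as a real vector space. -/
abbrev Herm (d : ℕ) : Submodule ℝ (Matrix (Fin d) (Fin d) ℂ) :=
  selfAdjoint.submodule ℝ (Matrix (Fin d) (Fin d) ℂ)

/-- The exponential map of `U(d)`. -/
def expU {d : ℕ} (ξ : LieU d) : U d :=
  ⟨NormedSpace.exp (ξ : Matrix (Fin d) (Fin d) ℂ), by
    have h : (ξ : Matrix (Fin d) (Fin d) ℂ)ᴴ = -ξ := ξ.2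
    rw [Matrix.mem_unitaryGroup_iff, Matrix.star_eq_conjTranspose, ← Matrix.exp_conjTranspose, h,
      ← Matrix.exp_add_of_commute _ _ (Commute.neg_right (Commute.refl (ξ : Matrix (Fin d) (Fin d) ℂ))), add_neg_cancel,
      NormedSpace.exp_zero]⟩

/-- The adjoint action `Ad_A η = A η A*` of `U(d)` on its Lie algebra. -/
def adU {d : ℕ} (A : U d) : LieU d →ₗ[ℝ] LieU d where
  toFun η := ⟨(A : Matrix (Fin d) (Fin d) ℂ) * η * (A : Matrix (Fin d) (Fin d) ℂ)ᴴ, by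
    have h : (η : Matrix (Fin d) (Fin d) ℂ)ᴴ = -η := η.2
    change _ᴴ = -_
    simp [Matrix.conjTranspose_mul, h, Matrix.mul_assoc]⟩
  map_add' x y := by ext1; simp [mul_add, add_mul]
  map_smul' c x := by ext1; simp

/-- The coadjoint action `(Ad*_A φ)(η) = φ (A* η A)` of `U(d)` on the dual of its Lie algebra. -/
def coadU {d : ℕ} (A : U d) (φ : Module.Dual ℝ (LieU d)) : Module.Dual ℝ (LieU d) :=
  φ ∘ₗ adU A⁻¹

/-- `(i/2) tr (η* ξ)` is real for `η` skew-Hermitian and `ξ` Hermitian. -/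
theorem alpha_im {d : ℕ} (ξ : Herm d) (η : LieU d) :
    (Complex.I / 2 * Matrix.trace ((η : Matrix (Fin d) (Fin d) ℂ)ᴴ * (ξ : Matrix (Fin d) (Fin d) ℂ))).im = 0 := by
  have hη : (η : Matrix (Fin d) (Fin d) ℂ)ᴴ = -η := η.2
  have hξ : (ξ : Matrix (Fin d) (Fin d) ℂ)ᴴ = ξ := ξ.2
  have h := Matrix.trace_conjTranspose ((η : Matrix (Fin d) (Fin d) ℂ)ᴴ * (ξ : Matrix (Fin d) (Fin d) ℂ))
  rw [Matrix.conjTranspose_mul, Matrix.conjTranspose_conjTranspose, hξ, Matrix.trace_mul_comm,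
    hη, Matrix.neg_mul, Matrix.trace_neg] at h
  have h2 := congrArg Complex.re h
  simp only [Complex.star_def, map_neg, Complex.neg_re, Complex.conj_re] at h2
  rw [hη, Matrix.neg_mul, Matrix.trace_neg, Complex.mul_im]
  simp
  linarith

/-- The map `α : H(d) → u(d)*`, `α_ξ(η) = (i/2) tr (η* ξ)`; this number is real by `alpha_im`. -/
def alpha (d : ℕ) : Herm d →ₗ[ℝ] Module.Dual ℝ (LieU d) :=
  LinearMap.mk₂ ℝ
    (fun ξ η => (Complex.I / 2 * Matrix.trace ((η : Matrix (Fin d) (Fin d) ℂ)ᴴ * (ξ : Matrix (Fin d) (Fin d) ℂ))).re)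
    (by intros; simp [mul_add])
    (by intros; simp; ring)
    (by intros; simp [add_mul, mul_add])
    (by intros; simp; ring)

/-! ### Hamiltonian actions of `U(d)`, regular values, orbit spaces -/

section Hamiltonian

variable {d : ℕ} {E : Type*} [NormedAddCommGroup E] [NormedSpace ℝ E] [MulAction (U d) E]

/-- The vector field `X^ξ` generated by `ξ`: `X^ξ_p = d/dt|_{t=0} exp (t ξ) • p`. -/
def fundamentalField (ξ : LieU d) (p : E) : E :=
  deriv (fun t : ℝ => expU (t • ξ) • p) 0

/-- `Φ : E → u(d)*` is a momentum map for the action of `U(d)` on `(E, σ)`, where `E` is a vector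
space regarded as a manifold. Smoothness of the action `U(d) × E → E` is expressed by a smooth
extension to the ambient space of the closed submanifold `U(d) × E`. -/
structure IsMomentumMap (σ : VectorSpaceTwoForm E) (Φ : E → Module.Dual ℝ (LieU d)) : Prop where
  smooth_action : ∃ Ψ : Matrix (Fin d) (Fin d) ℂ × E → E, ContDiff ℝ ∞ Ψ ∧
    ∀ (A : U d) (p : E), Ψ ((A : Matrix (Fin d) (Fin d) ℂ), p) = A • p
  preserves_form : ∀ A : U d, σ.pullback (fun p : E => A • p) = σ
  smooth : ∀ ξ : LieU d, ContDiff ℝ ∞ (fun p => Φ p ξ)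
  hamilton : ∀ (ξ : LieU d) (p Y : E),
    (σ p : AltForm E) ![fundamentalField (E := E) ξ p, Y] = fderiv ℝ (fun q : E => Φ q ξ) p Y
  equivariant : ∀ (A : U d) (p : E), Φ (A • p) = coadU A (Φ p)

end Hamiltonian

/-- `y` is a regular value of `f`: it is a value of `f`, and the differential of `f` is surjective
at every point of the fibre over `y`. -/
def IsRegularValue {E F : Type*} [NormedAddCommGroup E] [NormedSpace ℝ E]
    [NormedAddCommGroup F] [NormedSpace ℝ F] (f : E → F) (y : F) : Prop :=
  y ∈ Set.range f ∧ ∀ x, f x = y → Function.Surjective (fderiv ℝ f x)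

/-- The quotient of a subset `S` of a `G`-space, in the subspace topology, by the relation of lying
in the same `G`-orbit; it carries the quotient topology. -/
abbrev OrbitSpace (G : Type*) [Group G] {M : Type*} [MulAction G M] (S : Set M) : Type _ :=
  Quotient ((MulAction.orbitRel G M).comap (Subtype.val : S → M))

/-- The projection `q : S → S / G`. -/
def orbitProj (G : Type*) [Group G] {M : Type*} [MulAction G M] (S : Set M) :
    S → OrbitSpace G S :=
  Quotient.mk _

section Reduction

variable (G : Type*) [Group G] {E : Type*} [NormedAddCommGroup E] [NormedSpace ℝ E]
  [MulAction G E] (S : Set E)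
  (V : Type*) [NormedAddCommGroup V] [NormedSpace ℝ V]
  (W : Type*) [NormedAddCommGroup W] [NormedSpace ℝ W]

/-- The given atlases make `S` an embedded smooth submanifold of `E` (its topology is the subspace
topology) and `S / G` (with the quotient topology) a smooth manifold such that the projection
`S → S / G` is a smooth submersion. -/
structure IsSmoothReduction [ChartedSpace V S] [ChartedSpace W (OrbitSpace G S)] : Prop where
  manifold_level : IsManifold 𝓘(ℝ, V) ∞ S
  manifold_quotient : IsManifold 𝓘(ℝ, W) ∞ (OrbitSpace G S)
  t2_quotient : T2Space (OrbitSpace G S)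
  secondCountable_quotient : SecondCountableTopology (OrbitSpace G S)
  smooth_incl : ContMDiff 𝓘(ℝ, V) 𝓘(ℝ, E) ∞ (Subtype.val : S → E)
  immersion_incl : ∀ p : S,
    Function.Injective (mfderiv 𝓘(ℝ, V) 𝓘(ℝ, E) (Subtype.val : S → E) p)
  smooth_proj : ContMDiff 𝓘(ℝ, V) 𝓘(ℝ, W) ∞ (orbitProj G S)
  submersion_proj : ∀ p : S,
    Function.Surjective (mfderiv 𝓘(ℝ, V) 𝓘(ℝ, W) (orbitProj G S) p)

/-- The orbit space `S / G` of a subset `S` of `(E, σ)` is a reduced symplectic manifold: for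
suitable atlases, `S` is an `m`-dimensional embedded submanifold `ι : S → E` and `S / G` is an
`n`-dimensional manifold with submersion `q : S → S / G`, and there is a unique symplectic form
`σred` on `S / G` such that `q^* σred = ι^* σ`. -/
def HasReducedSymplecticForm (σ : VectorSpaceTwoForm E) (m n : ℕ) : Prop :=
  ∃ (_ : ChartedSpace (EuclideanSpace ℝ (Fin m)) S)
    (_ : ChartedSpace (EuclideanSpace ℝ (Fin n)) (OrbitSpace G S)),
    IsSmoothReduction G S (EuclideanSpace ℝ (Fin m)) (EuclideanSpace ℝ (Fin n)) ∧
    ∃! σred : TwoForm (EuclideanSpace ℝ (Fin n)) (OrbitSpace G S),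
      IsSymplecticForm σred ∧
      (σred.pullback (orbitProj G S) : TwoForm (EuclideanSpace ℝ (Fin m)) S) =
        TwoForm.pullback (Subtype.val : S → E) σ

end Reduction

/-! ### The space of matrices and tight frames -/

/-- The action of `U(d)` on `d × N` matrices by left multiplication. -/
instance leftMulAction (d N : ℕ) : MulAction (U d) (Matrix (Fin d) (Fin N) ℂ) where
  smul A F := (A : Matrix (Fin d) (Fin d) ℂ) * F
  one_smul F := by
    change ((1 : U d) : Matrix (Fin d) (Fin d) ℂ) * F = F
    rw [OneMemClass.coe_one, Matrix.one_mul]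
  mul_smul A B F := by
    change ((A * B : U d) : Matrix (Fin d) (Fin d) ℂ) * F =
      (A : Matrix (Fin d) (Fin d) ℂ) * ((B : Matrix (Fin d) (Fin d) ℂ) * F)
    rw [Submonoid.coe_mul, Matrix.mul_assoc]

/-- The alternating form `(X, Y) ↦ - Im tr (Y* X)` on `d × N` matrices. -/
def stdAlt (d N : ℕ) : AltForm (Matrix (Fin d) (Fin N) ℂ) where
  toFun v := -(Matrix.trace ((v 1)ᴴ * v 0)).im
  map_update_add' := by
    intro hdec m i x y
    rw [Subsingleton.elim hdec inferInstance]
    fin_cases i <;> simp [Matrix.mul_add, Matrix.add_mul] <;> ring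
  map_update_smul' := by
    intro hdec m i c x
    rw [Subsingleton.elim hdec inferInstance]
    fin_cases i <;> simp
  cont := by
    have h0 : Continuous fun v : Fin 2 → Matrix (Fin d) (Fin N) ℂ => v 0 := continuous_apply 0
    have h1 : Continuous fun v : Fin 2 → Matrix (Fin d) (Fin N) ℂ => v 1 := continuous_apply 1
    exact (Complex.continuous_im.comp (h1.matrix_conjTranspose.matrix_mul h0).matrix_trace).neg
  map_eq_zero_of_eq' := by
    intro v i j hv hij
    have h01 : v 0 = v 1 := by
      fin_cases i <;> fin_cases j <;> simp_all
    have h := congrArg Complex.im (Matrix.trace_conjTranspose ((v 1)ᴴ * v 0))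
    rw [Matrix.conjTranspose_mul, Matrix.conjTranspose_conjTranspose, h01] at h
    simp only [Complex.star_def, Complex.conj_im] at h
    rw [h01]
    linarith

/-- The standard symplectic form `σ_F(X, Y) = - Im tr (Y* X)` on `d × N` matrices. -/
def stdForm (d N : ℕ) : VectorSpaceTwoForm (Matrix (Fin d) (Fin N) ℂ) :=
  fun _ => stdAlt d N

/-- The map `F ↦ -F F*` with values in Hermitian matrices. -/
def momentum (d N : ℕ) (F : Matrix (Fin d) (Fin N) ℂ) : Herm d :=
  ⟨-(F * Fᴴ), by
    change _ᴴ = _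
    simp [Matrix.conjTranspose_mul]⟩

/-- The columns of `F` form a frame of `ℂ^d` with frame bounds `0 < a ≤ b`. -/
def IsFrameWithBounds {d N : ℕ} (a b : ℝ) (F : Matrix (Fin d) (Fin N) ℂ) : Prop :=
  0 < a ∧ a ≤ b ∧ ∀ v : EuclideanSpace ℂ (Fin d),
    a * ‖v‖ ^ 2 ≤ ∑ i, ‖inner ℂ v (WithLp.toLp 2 (fun k => F k i))‖ ^ 2 ∧
      ∑ i, ‖inner ℂ v (WithLp.toLp 2 (fun k => F k i))‖ ^ 2 ≤ b * ‖v‖ ^ 2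

/-- The space of `a`-tight frames of `N` vectors in `ℂ^d`. -/
def tightFrames (d N : ℕ) (a : ℝ) : Set (Matrix (Fin d) (Fin N) ℂ) :=
  {F | IsFrameWithBounds a a F}

end FrameReduction

end

open FrameReduction

/-! Write c = N/d. The differential of Φ(F) = -FF* at F is T ↦ -(FT* + TF*), and one trace
computation (`stdAlt_lie_mul`) gives the momentum identity ω(ξF, Y) = ⟨dΦ_F(Y), ξ⟩. If FF* is
invertible, T = -½ K (FF*)⁻¹ F maps to K. Conversely, if dΦ_F hits the identity, no nonzero row
vector kills F, so FF* is positive definite. Since d ≤ N, every positive definite matrix is of the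
form FF*.

The quotient is built by explicit charts, without a general slice theorem. Two frames with FF* = c
are in one U(d)-orbit exactly when they have the same row space, so the quotient is a Grassmannian.
Near F₀, a row space has a unique basis G with G F₀* = 1, that is G = F₀/c + Y with Y F₀* = 0, and Y
is an affine coordinate. A smooth inverse square root of cGG* turns G back into a tight frame
(`frameSection`), which gives a smooth local section. A nearby tight frame is a unitary matrix times
such a section; the Cayley transform linearizes the unitary factor and yields charts of the level
set.

All these charts are restrictions of smooth maps on open sets of matrices, and their inverses lift
to smooth matrix-valued maps. `SliceAtlas` records this, so that calculus on both manifolds reduces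
to Fréchet derivatives in vector spaces. The reduced form is the pullback of ω along the local
sections. It is independent of the section because families of tight frames differing by unitaries
have derivatives that differ, up to a unitary, by vectors ξF, which are ω-orthogonal to ker dΦ_F
(`stdAlt_deriv_eq`). It is closed as a local pullback of a constant form. It is nondegenerate
because a vector T of ker dΦ_F orthogonal to ker dΦ_F splits as Z + ξF with ZF* = 0; then iZ is also
in the kernel, and ω(Z, iZ) = tr(Z*Z) forces Z = 0 (`exists_lie_mul_eq`). Uniqueness holds because q
is a surjective submersion. -/

namespace FrameReduction

/-! ### Pullbacks of constant two-forms: smoothness and closedness. -/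

section AlternatingPullback

variable {E F : Type*} [NormedAddCommGroup E] [NormedSpace ℝ E]
  [NormedAddCommGroup F] [NormedSpace ℝ F]

/-- Antisymmetrization of continuous bilinear maps, as a continuous linear map. -/
noncomputable def antisymmCLM (E : Type*) [NormedAddCommGroup E] [NormedSpace ℝ E] :
    ContinuousMultilinearMap ℝ (fun _ : Fin 2 => E) ℝ →L[ℝ] (E [⋀^Fin 2]→L[ℝ] ℝ) :=
  LinearMap.mkContinuous
    { toFun := fun f => ContinuousMultilinearMap.alternatization f
      map_add' := map_add _
      map_smul' := fun c f => by
        ext v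
        simp [ContinuousMultilinearMap.alternatization_apply_apply, Finset.mul_sum,
          mul_smul_comm] } 2 (by
    intro f
    refine ContinuousAlternatingMap.opNorm_le_bound _ (by positivity) fun v => ?_
    simp only [LinearMap.coe_mk, AddHom.coe_mk,
      ContinuousMultilinearMap.alternatization_apply_apply]
    refine (norm_sum_le _ _).trans ?_
    have h : ∀ σ ∈ (Finset.univ : Finset (Equiv.Perm (Fin 2))),
        ‖Equiv.Perm.sign σ • f (v ∘ σ)‖ ≤ ‖f‖ * ∏ i, ‖v i‖ := by
      intro σ _
      have h1 : ‖Equiv.Perm.sign σ • f (v ∘ σ)‖ = ‖f (v ∘ σ)‖ := by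
        rcases Int.units_eq_one_or (Equiv.Perm.sign σ) with h | h <;> simp [h]
      rw [h1]
      refine (f.le_opNorm _).trans_eq ?_
      congr 1
      exact Equiv.prod_comp σ (fun i => ‖v i‖)
    refine (Finset.sum_le_sum h).trans_eq ?_
    simp [Fintype.card_perm, mul_assoc])

/-- Each of the 2! permutations contributes θ itself, whence the factor 2. -/
theorem antisymmCLM_alternating (θ : E [⋀^Fin 2]→L[ℝ] ℝ) :
    antisymmCLM E θ.toContinuousMultilinearMap = (2 : ℝ) • θ := by
  ext v
  have h : ∀ σ : Equiv.Perm (Fin 2), Equiv.Perm.sign σ • θ (v ∘ σ) = θ v := by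
    intro σ
    have := θ.toAlternatingMap.map_perm v σ
    change θ (v ∘ σ) = Equiv.Perm.sign σ • θ v at this
    rw [this, smul_smul]
    simp
  have h2 : antisymmCLM E θ.toContinuousMultilinearMap v =
      ∑ σ : Equiv.Perm (Fin 2), Equiv.Perm.sign σ • θ (v ∘ σ) := by
    simp [antisymmCLM, ContinuousMultilinearMap.alternatization_apply_apply]
  rw [h2, Finset.sum_congr rfl fun σ _ => h σ]
  simp [Fintype.card_perm]

/-- Pulling back a fixed alternating form is smooth in the linear map. -/
theorem contDiff_compContinuousLinearMap (θ : F [⋀^Fin 2]→L[ℝ] ℝ) :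
    ContDiff ℝ ∞ (fun L : E →L[ℝ] F => θ.compContinuousLinearMap L) := by
  have h1 : ContDiff ℝ ∞ (fun L : E →L[ℝ] F =>
      θ.toContinuousMultilinearMap.compContinuousLinearMap (fun _ : Fin 2 => L)) := by
    have h := ContinuousMultilinearMap.contDiff (𝕜 := ℝ) (n := ∞) (E := fun _ : Fin 2 => E →L[ℝ] F)
      (F := (F [×2]→L[ℝ] ℝ) →L[ℝ] E [×2]→L[ℝ] ℝ)
      (ContinuousMultilinearMap.compContinuousLinearMapContinuousMultilinear ℝ
        (fun _ : Fin 2 => E) (fun _ => F) ℝ)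
    have h2 : ContDiff ℝ ∞ (fun L : E →L[ℝ] F => (fun _ : Fin 2 => L)) :=
      contDiff_pi.2 fun _ => contDiff_id
    exact (h.comp h2).clm_apply contDiff_const
  -- An alternating form is half its antisymmetrization, so smoothness of the multilinear pullback
  -- passes to alternating forms through a continuous linear map.
  have h3 := (((2 : ℝ)⁻¹ • antisymmCLM E).contDiff (n := ∞)).comp h1
  convert h3 using 2 with L
  have := antisymmCLM_alternating (θ.compContinuousLinearMap L)
  simp only [Function.comp_apply, smul_apply]
  erw [this]
  simp

/-- The pullback of a constant form by a smooth map is closed. -/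
theorem extDeriv_comp_fderiv_const (θ : F [⋀^Fin 2]→L[ℝ] ℝ) {f : E → F} {x : E}
    (hf : ContDiffAt ℝ ∞ f x) :
    extDeriv (fun x => θ.compContinuousLinearMap (fderiv ℝ f x)) x = 0 := by
  have hc : DifferentiableAt ℝ (fun _ : F => θ) (f x) := differentiableAt_const θ
  have h := extDeriv_pullback hc hf (by simpa using WithTop.coe_le_coe.2 (le_top : (2 : ℕ∞) ≤ ⊤))
  rw [h]
  have : extDeriv (fun _ : F => θ) (f x) = 0 := by
    ext v
    rw [extDeriv_apply hc]
    simp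
  rw [this]
  ext v; simp

end AlternatingPullback

/-! ### Atlases with ambient coordinates and liftable inverses; the abstract reduction criterion. -/

section SliceAtlas

open Topology Filter Set

variable {E V W W' : Type*} [NormedAddCommGroup E] [NormedSpace ℝ E]
  [NormedAddCommGroup V] [NormedSpace ℝ V] [NormedAddCommGroup W] [NormedSpace ℝ W]
  [NormedAddCommGroup W'] [NormedSpace ℝ W']
  {S : Set E} {X : Type*} [TopologicalSpace X]

/-- An atlas of a quotient `q : S → X` of a subset `S` of a vector space `E`, whose charts are
induced by smooth maps defined on open subsets of `E`, and whose inverse charts lift to smooth maps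
into `E` with values in `S`. -/
structure SliceAtlas (S : Set E) (q : S → X) (W : Type*) [NormedAddCommGroup W]
    [NormedSpace ℝ W] where
  chart : X → OpenPartialHomeomorph X W
  mem_source : ∀ x, x ∈ (chart x).source
  lift : X → W → S
  proj_lift : ∀ x, ∀ w ∈ (chart x).target, q (lift x w) = (chart x).symm w
  contDiffOn_lift : ∀ x, ContDiffOn ℝ ∞ (fun w => (lift x w : E)) (chart x).target
  coord : X → E → W
  dom : X → Set E
  isOpen_dom : ∀ x, IsOpen (dom x)
  contDiffOn_coord : ∀ x, ContDiffOn ℝ ∞ (coord x) (dom x)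
  mem_dom : ∀ x (p : S), q p ∈ (chart x).source → (p : E) ∈ dom x
  coord_eq : ∀ x (p : S), q p ∈ (chart x).source → chart x (q p) = coord x p

namespace SliceAtlas

variable {q : S → X} (B : SliceAtlas S q W)

/-- The charted space structure given by a slice atlas. -/
@[reducible] def chartedSpace : ChartedSpace W X where
  atlas := range B.chart
  chartAt := B.chart
  mem_chart_source := B.mem_source
  chart_mem_atlas x := ⟨x, rfl⟩

theorem contDiffAt_lift {x : X} {w : W} (hw : w ∈ (B.chart x).target) :
    ContDiffAt ℝ ∞ (fun w => (B.lift x w : E)) w :=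
  (B.contDiffOn_lift x).contDiffAt ((B.chart x).open_target.mem_nhds hw)

theorem contDiffAt_coord {x : X} {p : E} (hp : p ∈ B.dom x) : ContDiffAt ℝ ∞ (B.coord x) p :=
  (B.contDiffOn_coord x).contDiffAt ((B.isOpen_dom x).mem_nhds hp)

theorem mem_dom_proj (p : S) : (p : E) ∈ B.dom (q p) := B.mem_dom _ _ (B.mem_source _)

theorem lift_mem_dom {x y : X} {w : W} (hw : w ∈ (B.chart x).target)
    (hy : (B.chart x).symm w ∈ (B.chart y).source) : (B.lift x w : E) ∈ B.dom y :=
  B.mem_dom y _ (by rwa [B.proj_lift x w hw])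

theorem coord_lift {x y : X} {w : W} (hw : w ∈ (B.chart x).target)
    (hy : (B.chart x).symm w ∈ (B.chart y).source) :
    B.coord y (B.lift x w) = B.chart y ((B.chart x).symm w) := by
  rw [← B.coord_eq y _ (by rwa [B.proj_lift x w hw]), B.proj_lift x w hw]

/-- A transition map is an ambient coordinate composed with a lift, hence a composite of smooth maps
between vector spaces. -/
theorem isManifold : letI := B.chartedSpace; IsManifold 𝓘(ℝ, W) ∞ X := by
  let _ := B.chartedSpace
  refine isManifold_of_contDiffOn _ _ _ ?_
  rintro _ _ ⟨x, rfl⟩ ⟨y, rfl⟩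
  simp only [modelWithCornersSelf_coe, modelWithCornersSelf_coe_symm, Function.comp_id,
    Function.id_comp, preimage_id, range_id, inter_univ]
  have h : ContDiffOn ℝ ∞ (fun w => B.coord y (B.lift x w))
      ((B.chart x).symm.trans (B.chart y)).source := by
    intro w hw
    rw [OpenPartialHomeomorph.trans_source] at hw
    have hw1 : w ∈ (B.chart x).target := hw.1
    have hc := B.contDiffAt_coord (B.lift_mem_dom hw1 hw.2)
    exact (ContDiffAt.comp w hc (B.contDiffAt_lift hw1)).contDiffWithinAt
  refine h.congr fun w hw => ?_
  rw [OpenPartialHomeomorph.trans_source] at hw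
  exact (B.coord_lift (x := x) hw.1 hw.2).symm

end SliceAtlas

theorem mfderiv_eq_fderiv_chart {M M' : Type*} [TopologicalSpace M] [ChartedSpace V M]
    [TopologicalSpace M'] [ChartedSpace W M'] {f : M → M'} {p : M}
    (hf : MDifferentiableAt 𝓘(ℝ, V) 𝓘(ℝ, W) f p) :
    mfderiv 𝓘(ℝ, V) 𝓘(ℝ, W) f p =
      fderiv ℝ (chartAt W (f p) ∘ f ∘ (chartAt V p).symm) (chartAt V p p) := by
  simp only [mfderiv, hf, writtenInExtChartAt, extChartAt, mfld_simps]
  rw [fderivWithin_univ]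
  rfl

namespace SliceAtlas

variable {q : S → X} (A : SliceAtlas S (id : S → S) V) (B : SliceAtlas S q W)

theorem lift_eq_symm (p : S) {v : V} (hv : v ∈ (A.chart p).target) :
    A.lift p v = (A.chart p).symm v := A.proj_lift p v hv

/-- The inclusion of `S`, in the chart at `p`. -/
def param (p : S) (v : V) : E := A.lift p v

/-- The image of `p` in its chart. -/
def base (x : X) : W := B.chart x x

theorem base_mem (x : X) : B.base x ∈ (B.chart x).target :=
  (B.chart x).map_source (B.mem_source x)

theorem contDiffAt_param (p : S) : ContDiffAt ℝ ∞ (A.param p) (A.base p) :=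
  A.contDiffAt_lift (A.base_mem p)

theorem param_base (p : S) : A.param p (A.base p) = p := by
  rw [param, A.lift_eq_symm p (A.base_mem p), base, (A.chart p).left_inv (A.mem_source p)]

/-- The differential of the inclusion of `S` at `p`. -/
noncomputable def inclDeriv (p : S) : V →L[ℝ] E := fderiv ℝ (A.param p) (A.base p)

theorem hasFDerivAt_param (p : S) : HasFDerivAt (A.param p) (A.inclDeriv p) (A.base p) :=
  ((A.contDiffAt_param p).differentiableAt (by simp)).hasFDerivAt

theorem hasFDerivAt_coord (p : S) :
    HasFDerivAt (B.coord (q p)) (fderiv ℝ (B.coord (q p)) p) (p : E) :=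
  ((B.contDiffAt_coord (B.mem_dom_proj p)).differentiableAt (by simp)).hasFDerivAt

theorem contMDiff_val :
    letI := A.chartedSpace; ContMDiff 𝓘(ℝ, V) 𝓘(ℝ, E) ∞ (Subtype.val : S → E) := by
  let _ := A.chartedSpace
  intro p
  rw [contMDiffAt_iff]
  refine ⟨continuous_subtype_val.continuousAt, ?_⟩
  simp only [extChartAt, mfld_simps]
  rw [contDiffWithinAt_univ]
  refine (A.contDiffAt_param p).congr_of_eventuallyEq ?_
  filter_upwards [(A.chart p).open_target.mem_nhds (A.base_mem p)] with v hv
  simp only [param, A.lift_eq_symm p hv, mfld_simps]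
  rfl

theorem mfderiv_val (p : S) :
    letI := A.chartedSpace
    mfderiv 𝓘(ℝ, V) 𝓘(ℝ, E) (Subtype.val : S → E) p = A.inclDeriv p := by
  let _ := A.chartedSpace
  rw [mfderiv_eq_fderiv_chart ((A.contMDiff_val p).mdifferentiableAt (by simp))]
  refine EventuallyEq.fderiv_eq ?_
  filter_upwards [(A.chart p).open_target.mem_nhds (A.base_mem p)] with v hv
  simp only [param, A.lift_eq_symm p hv, mfld_simps]
  rfl

/-- A differentiable map with values in `S` has its derivative in the range of the differential of
the inclusion. -/
theorem fderiv_eq_inclDeriv_comp (p : S) {f : W' → E} {w : W'} {f' : W' →L[ℝ] E}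
    (hf : HasFDerivAt f f' w) (hp : f w = p) (hS : ∀ᶠ z in 𝓝 w, f z ∈ S) :
    f' = A.inclDeriv p ∘L (fderiv ℝ (A.coord p) p) ∘L f' := by
  have h1 : HasFDerivAt (A.coord p) (fderiv ℝ (A.coord p) p) (f w) := by
    rw [hp]; exact A.hasFDerivAt_coord p
  have hb : A.coord p (f w) = A.base p := by
    rw [hp]; exact (A.coord_eq p p (A.mem_source p)).symm
  have h2 : HasFDerivAt (A.param p) (A.inclDeriv p) ((A.coord p ∘ f) w) := by
    rw [Function.comp_apply, hb]; exact A.hasFDerivAt_param p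
  have h3 := h2.comp w (h1.comp w hf)
  refine hf.unique (h3.congr_of_eventuallyEq ?_)
  -- The chart source is open only in S; an ambient open set O inducing it is needed to use
  -- continuity of f as a map into E.
  obtain ⟨O, hO, hOs⟩ := isOpen_induced_iff.1 (A.chart p).open_source
  have hpO : f w ∈ O := by
    rw [hp]
    have : p ∈ (Subtype.val ⁻¹' O : Set S) := by rw [hOs]; exact A.mem_source p
    exact this
  filter_upwards [hS, hf.continuousAt.preimage_mem_nhds (hO.mem_nhds hpO)] with z hz hzO
  have hs : (⟨f z, hz⟩ : S) ∈ (A.chart p).source := by rw [← hOs]; exact hzO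
  have h4 := A.coord_eq p ⟨f z, hz⟩ hs
  simp only [Function.comp_apply, param]
  rw [← h4, id, A.lift_eq_symm p ((A.chart p).map_source hs), (A.chart p).left_inv hs]

/-- Differentiates the identity chart ∘ chart⁻¹ = id; this is why the inclusion is an immersion. -/
theorem coordDeriv_comp_inclDeriv (p : S) :
    (fderiv ℝ (A.coord p) p) ∘L A.inclDeriv p = ContinuousLinearMap.id ℝ V := by
  have h1 : HasFDerivAt (A.coord p) (fderiv ℝ (A.coord p) p) (A.param p (A.base p)) := by
    rw [A.param_base]; exact A.hasFDerivAt_coord p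
  refine (h1.comp _ (A.hasFDerivAt_param p)).unique ((hasFDerivAt_id _).congr_of_eventuallyEq ?_)
  filter_upwards [(A.chart p).open_target.mem_nhds (A.base_mem p)] with v hv
  have := A.coord_lift (y := p) hv ((A.chart p).map_target hv)
  rw [(A.chart p).right_inv hv] at this
  exact this

theorem inclDeriv_injective (p : S) : Function.Injective (A.inclDeriv p) := by
  intro v w h
  have := congrArg (fderiv ℝ (A.coord p) p) h
  simpa [← ContinuousLinearMap.comp_apply, A.coordDeriv_comp_inclDeriv p] using this

theorem eventually_param_mem (hq : Continuous q) (p : S) : ∀ᶠ v in 𝓝 (A.base p),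
    A.param p v = (A.chart p).symm v ∧ q ((A.chart p).symm v) ∈ (B.chart (q p)).source := by
  have hc : ContinuousAt (fun v => q ((A.chart p).symm v)) (A.base p) :=
    hq.continuousAt.comp ((A.chart p).symm.continuousAt (A.base_mem p))
  have hm : q ((A.chart p).symm (A.base p)) ∈ (B.chart (q p)).source := by
    rw [base, (A.chart p).left_inv (A.mem_source p)]
    exact B.mem_source _
  filter_upwards [hc.preimage_mem_nhds ((B.chart (q p)).open_source.mem_nhds hm),
    (A.chart p).open_target.mem_nhds (A.base_mem p)] with v hv hvt
  exact ⟨by rw [param, A.lift_eq_symm p hvt], hv⟩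

theorem coord_param_eventuallyEq (hq : Continuous q) (p : S) :
    (B.chart (q p) ∘ q ∘ (A.chart p).symm) =ᶠ[𝓝 (A.base p)]
      (B.coord (q p) ∘ A.param p) := by
  filter_upwards [A.eventually_param_mem B hq p] with v hv
  simp only [Function.comp_apply, hv.1]
  exact B.coord_eq _ _ hv.2

theorem contMDiff_proj (hq : Continuous q) :
    letI := A.chartedSpace; letI := B.chartedSpace
    ContMDiff 𝓘(ℝ, V) 𝓘(ℝ, W) ∞ q := by
  let _ := A.chartedSpace
  let _ := B.chartedSpace
  intro p
  rw [contMDiffAt_iff]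
  refine ⟨hq.continuousAt, ?_⟩
  simp only [extChartAt, mfld_simps]
  rw [contDiffWithinAt_univ]
  have h1 : ContDiffAt ℝ ∞ (B.coord (q p)) (A.param p (A.base p)) := by
    rw [A.param_base]; exact B.contDiffAt_coord (B.mem_dom_proj p)
  exact (h1.comp _ (A.contDiffAt_param p)).congr_of_eventuallyEq
    (A.coord_param_eventuallyEq B hq p)

theorem mfderiv_proj (hq : Continuous q) (p : S) :
    letI := A.chartedSpace; letI := B.chartedSpace
    mfderiv 𝓘(ℝ, V) 𝓘(ℝ, W) q p = (fderiv ℝ (B.coord (q p)) p) ∘L A.inclDeriv p := by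
  let _ := A.chartedSpace
  let _ := B.chartedSpace
  rw [mfderiv_eq_fderiv_chart ((A.contMDiff_proj B hq p).mdifferentiableAt (by simp))]
  refine ((A.coord_param_eventuallyEq B hq p).fderiv_eq).trans ?_
  have h1 : HasFDerivAt (B.coord (q p)) (fderiv ℝ (B.coord (q p)) p)
      (A.param p (A.base p)) := by
    rw [A.param_base]; exact B.hasFDerivAt_coord p
  exact (h1.comp _ (A.hasFDerivAt_param p)).fderiv

/-- If a smooth local section of `q` passes through `p`, then `q` is a submersion at `p`. -/
theorem coordDeriv_inclDeriv_surjective (p : S) {f : W → S}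
    (hf : DifferentiableAt ℝ (fun w => (f w : E)) (B.base (q p)))
    (hp : f (B.base (q p)) = p)
    (hsec : ∀ᶠ w in 𝓝 (B.base (q p)), q (f w) = (B.chart (q p)).symm w) :
    Function.Surjective ((fderiv ℝ (B.coord (q p)) p) ∘L A.inclDeriv p) := by
  set w₀ := B.base (q p) with hw₀
  set f' := fderiv ℝ (fun w => (f w : E)) w₀
  have h1 : HasFDerivAt (B.coord (q p)) (fderiv ℝ (B.coord (q p)) p) (f w₀ : E) := by
    rw [hp]; exact B.hasFDerivAt_coord p
  have h2 : (fderiv ℝ (B.coord (q p)) p) ∘L f' = ContinuousLinearMap.id ℝ W := by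
    refine (h1.comp w₀ hf.hasFDerivAt).unique
      ((hasFDerivAt_id _).congr_of_eventuallyEq ?_)
    filter_upwards [hsec, (B.chart (q p)).open_target.mem_nhds (B.base_mem (q p))] with w hw hwt
    have h3 : q (f w) ∈ (B.chart (q p)).source := by
      rw [hw]; exact (B.chart (q p)).map_target hwt
    simp only [Function.comp_apply, id]
    rw [← B.coord_eq _ _ h3, hw, (B.chart (q p)).right_inv hwt]
  -- The section takes values in S, so its derivative is tangent to S; this turns the ambient right
  -- inverse into preimages in V.
  have h3 := A.fderiv_eq_inclDeriv_comp p hf.hasFDerivAt (by rw [hp])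
    (Eventually.of_forall fun z => (f z).2)
  intro w
  refine ⟨(fderiv ℝ (A.coord p) p) (f' w), ?_⟩
  have h4 := DFunLike.congr_fun h3 w
  have h5 := DFunLike.congr_fun h2 w
  simp only [ContinuousLinearMap.comp_apply, ContinuousLinearMap.id_apply] at h4 h5 ⊢
  rw [← h4, h5]

/-- The two-form on the quotient induced by a constant form on the ambient space, by means of the
local sections. -/
noncomputable def reducedForm (θ : E [⋀^Fin 2]→L[ℝ] ℝ) :
    letI := B.chartedSpace; TwoForm W X :=
  fun x => θ.compContinuousLinearMap (fderiv ℝ (fun w => (B.lift x w : E)) (B.base x))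

/-- The derivative of `p ↦ s (q p)` along `S`, where `s` is the local section at `q p`. -/
noncomputable def slideDeriv (p : S) : V →L[ℝ] E :=
  fderiv ℝ (fun w => (B.lift (q p) w : E)) (B.base (q p)) ∘L
    fderiv ℝ (B.coord (q p)) p ∘L A.inclDeriv p

theorem hasFDerivAt_slide (p : S) :
    HasFDerivAt (fun v => (B.lift (q p) (B.coord (q p) (A.param p v)) : E)) (A.slideDeriv B p)
      (A.base p) := by
  have hb : B.coord (q p) (A.param p (A.base p)) = B.base (q p) := by
    rw [A.param_base]
    exact (B.coord_eq _ p (B.mem_source _)).symm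
  have h1 : HasFDerivAt (B.coord (q p)) (fderiv ℝ (B.coord (q p)) p)
      (A.param p (A.base p)) := by
    rw [A.param_base]; exact B.hasFDerivAt_coord p
  have h2 : HasFDerivAt (fun w => (B.lift (q p) w : E))
      (fderiv ℝ (fun w => (B.lift (q p) w : E)) (B.base (q p)))
      ((B.coord (q p) ∘ A.param p) (A.base p)) := by
    rw [Function.comp_apply, hb]
    exact ((B.contDiffAt_lift (B.base_mem _)).differentiableAt (by simp)).hasFDerivAt
  exact h2.comp (A.base p) (h1.comp (A.base p) (A.hasFDerivAt_param p))

/-- Sliding a point onto the local section stays in the same fibre of q, which is what allows the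
two derivatives to be compared by symmetry. -/
theorem eventually_proj_slide (hq : Continuous q) (p : S) : ∀ᶠ v in 𝓝 (A.base p),
    q (B.lift (q p) (B.coord (q p) (A.param p v))) = q (A.lift p v) := by
  filter_upwards [A.eventually_param_mem B hq p,
    (A.chart p).open_target.mem_nhds (A.base_mem p)] with v hv hvt
  rw [hv.1, A.lift_eq_symm p hvt, ← B.coord_eq _ _ hv.2,
    B.proj_lift _ _ ((B.chart (q p)).map_source hv.2), (B.chart (q p)).left_inv hv.2]

/-- The derivative of section ∘ q along S is `slideDeriv`, so `hθ` is precisely the required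
identity at each point. -/
theorem pullback_proj_reducedForm (hq : Continuous q) (θ : E [⋀^Fin 2]→L[ℝ] ℝ)
    (hθ : ∀ p, θ.compContinuousLinearMap (A.slideDeriv B p) =
      θ.compContinuousLinearMap (A.inclDeriv p)) :
    letI := A.chartedSpace; letI := B.chartedSpace
    ((B.reducedForm θ).pullback q : TwoForm V S) =
      TwoForm.pullback (Subtype.val : S → E) (fun _ => θ : VectorSpaceTwoForm E) := by
  let _ := A.chartedSpace
  let _ := B.chartedSpace
  funext p
  have h1 := A.mfderiv_proj B hq p
  have h2 := A.mfderiv_val p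
  simp only [TwoForm.pullback]
  erw [h1, h2]
  exact hθ p

/-- The reduced form at a point is defined by the section attached to that point, so a chart sees a
different section at each of its points. Since `hθ` makes the choice of section irrelevant, the
single section of the chart computes the form throughout its target. -/
theorem inChart_reducedForm (θ : E [⋀^Fin 2]→L[ℝ] ℝ)
    (hθ : ∀ p, θ.compContinuousLinearMap (A.slideDeriv B p) =
      θ.compContinuousLinearMap (A.inclDeriv p)) (x : X) {w : W} (hw : w ∈ (B.chart x).target) :
    letI := B.chartedSpace
    (B.reducedForm θ).inChart (B.chart x) w =
      θ.compContinuousLinearMap (fderiv ℝ (fun w => (B.lift x w : E)) w) := by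
  let _ := B.chartedSpace
  have _ := B.isManifold
  have _ : IsManifold 𝓘(ℝ, W) 1 X := IsManifold.of_le (n := ∞) (by simp)
  have hmd : MDifferentiableAt 𝓘(ℝ, W) 𝓘(ℝ, W) (B.chart x).symm w :=
    mdifferentiableAt_atlas_symm (I := 𝓘(ℝ, W)) (show B.chart x ∈ atlas W X from ⟨x, rfl⟩) hw
  set p : S := B.lift x w with hp
  have hqp : q p = (B.chart x).symm w := B.proj_lift x w hw
  have hl := (B.contDiffAt_lift hw).differentiableAt (by simp)
  set L := fderiv ℝ (fun w => (B.lift x w : E)) w with hL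
  have hLf : HasFDerivAt (fun w => (B.lift x w : E)) L w := hl.hasFDerivAt
  have h1 : mfderiv 𝓘(ℝ, W) 𝓘(ℝ, W) (B.chart x).symm w =
      fderiv ℝ (B.coord ((B.chart x).symm w)) p ∘L L := by
    rw [mfderiv_eq_fderiv_chart hmd]
    have h2 : HasFDerivAt (B.coord (q p)) (fderiv ℝ (B.coord (q p)) p) (B.lift x w : E) :=
      B.hasFDerivAt_coord p
    rw [← hqp]
    refine HasFDerivAt.fderiv ((h2.comp w hLf).congr_of_eventuallyEq ?_)
    have hc : ContinuousAt (B.chart x).symm w := (B.chart x).symm.continuousAt hw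
    have hm : (B.chart x).symm w ∈ (B.chart (q p)).source := by
      rw [← hqp]; exact B.mem_source _
    filter_upwards [(B.chart x).open_target.mem_nhds hw,
      hc.preimage_mem_nhds ((B.chart (q p)).open_source.mem_nhds hm)] with z hz hzs
    exact (B.coord_lift hz hzs).symm
  have h3 := A.fderiv_eq_inclDeriv_comp p hLf rfl (Eventually.of_forall fun z => (B.lift x z).2)
  have h4 := hθ p
  simp only [TwoForm.inChart, TwoForm.pullback, reducedForm]
  erw [h1]
  simp only [slideDeriv] at h4
  rw [← hqp, h3]
  ext v
  have h5 := DFunLike.congr_fun h4 (fun i => fderiv ℝ (A.coord p) p (L (v i)))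
  exact h5

/-- In each chart the form is a pullback of θ along one smooth section, hence smooth and closed. For
nondegeneracy, a tangent vector is lifted through the submersion, and `hnd` says that the radical of
θ on the tangent space of S dies in the quotient. -/
theorem isSymplecticForm_reducedForm (hsurj : Function.Surjective q)
    (θ : E [⋀^Fin 2]→L[ℝ] ℝ)
    (hθ : ∀ p, θ.compContinuousLinearMap (A.slideDeriv B p) =
      θ.compContinuousLinearMap (A.inclDeriv p))
    (hsub : ∀ p, Function.Surjective ((fderiv ℝ (B.coord (q p)) p) ∘L A.inclDeriv p))
    (hnd : ∀ (p : S) (v : V), (∀ v', θ ![A.inclDeriv p v, A.inclDeriv p v'] = 0) →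
      fderiv ℝ (B.coord (q p)) p (A.inclDeriv p v) = 0) :
    letI := B.chartedSpace
    IsSymplecticForm (B.reducedForm θ) := by
  let _ := B.chartedSpace
  refine ⟨?_, ?_, ?_⟩
  · rintro _ ⟨x, rfl⟩
    refine ContDiffOn.congr (f := fun w => θ.compContinuousLinearMap
      (fderiv ℝ (fun w => (B.lift x w : E)) w)) ?_
      fun w hw => A.inChart_reducedForm B θ hθ x hw
    refine (contDiff_compContinuousLinearMap θ).comp_contDiffOn ?_
    exact (B.contDiffOn_lift x).fderiv_of_isOpen (B.chart x).open_target (by simp)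
  · rintro _ ⟨x, rfl⟩ w hw
    refine Eq.trans ?_ (extDeriv_comp_fderiv_const θ (B.contDiffAt_lift hw))
    refine EventuallyEq.extDeriv_eq ?_
    filter_upwards [(B.chart x).open_target.mem_nhds hw] with z hz
    exact A.inChart_reducedForm B θ hθ x hz
  · intro x T hT
    obtain ⟨p, rfl⟩ := hsurj x
    obtain ⟨v, rfl⟩ := hsub p T
    refine hnd p v fun v' => ?_
    have h := hT (((fderiv ℝ (B.coord (q p)) p) ∘L A.inclDeriv p) v')
    have h2 := DFunLike.congr_fun (hθ p) ![v, v']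
    have e : ∀ L : V →L[ℝ] E, θ.compContinuousLinearMap L ![v, v'] = θ ![L v, L v'] := by
      intro L
      simp only [ContinuousAlternatingMap.compContinuousLinearMap_apply]
      congr 1
      ext i
      fin_cases i <;> rfl
    rw [e, e] at h2
    rw [← h2]
    refine Eq.trans ?_ h
    simp only [reducedForm, slideDeriv]
    erw [ContinuousAlternatingMap.compContinuousLinearMap_apply]
    congr 1
    ext i
    fin_cases i <;> rfl

/-- Every point and every tangent vector of the target lifts, so the pullback determines all values.
This is the uniqueness of the reduced form. -/
theorem twoForm_eq_of_pullback_eq {M M' : Type*} [TopologicalSpace M] [ChartedSpace V M]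
    [TopologicalSpace M'] [ChartedSpace W M'] {f : M → M'} (hf : Function.Surjective f)
    (hsub : ∀ p, Function.Surjective (mfderiv 𝓘(ℝ, V) 𝓘(ℝ, W) f p)) {σ τ : TwoForm W M'}
    (h : (σ.pullback f : TwoForm V M) = τ.pullback f) : σ = τ := by
  funext x
  obtain ⟨p, rfl⟩ := hf x
  ext v
  choose u hu using fun i => hsub p (v i)
  have h2 := DFunLike.congr_fun (congrFun h p) u
  simp only [TwoForm.pullback, ContinuousAlternatingMap.compContinuousLinearMap_apply] at h2
  have h3 : (mfderiv 𝓘(ℝ, V) 𝓘(ℝ, W) f p) ∘ u = v := funext hu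
  rw [h3] at h2
  exact h2

end SliceAtlas

/-- A criterion for the existence of a reduced symplectic form, in terms of slice atlases. -/
theorem hasReducedSymplecticForm_of_sliceAtlas {G : Type*} [Group G] [MulAction G E]
    {m n : ℕ} (A : SliceAtlas S (id : S → S) (EuclideanSpace ℝ (Fin m)))
    (B : SliceAtlas S (orbitProj G S) (EuclideanSpace ℝ (Fin n)))
    (ht2 : T2Space (OrbitSpace G S)) (hsc : SecondCountableTopology (OrbitSpace G S))
    (θ : E [⋀^Fin 2]→L[ℝ] ℝ)
    (hθ : ∀ p, θ.compContinuousLinearMap (A.slideDeriv B p) =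
      θ.compContinuousLinearMap (A.inclDeriv p))
    (hsub : ∀ p, Function.Surjective
      ((fderiv ℝ (B.coord (orbitProj G S p)) p) ∘L A.inclDeriv p))
    (hnd : ∀ (p : S) (v), (∀ v', θ ![A.inclDeriv p v, A.inclDeriv p v'] = 0) →
      fderiv ℝ (B.coord (orbitProj G S p)) p (A.inclDeriv p v) = 0) :
    HasReducedSymplecticForm G S (fun _ => θ : VectorSpaceTwoForm E) m n := by
  have hq : Continuous (orbitProj G S) := continuous_quotient_mk'
  have hsurj : Function.Surjective (orbitProj G S) := Quotient.mk_surjective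
  let _ := A.chartedSpace
  let _ := B.chartedSpace
  have hsub' : ∀ p : S, Function.Surjective (mfderiv 𝓘(ℝ, EuclideanSpace ℝ (Fin m))
      𝓘(ℝ, EuclideanSpace ℝ (Fin n)) (orbitProj G S) p) := by
    intro p
    rw [A.mfderiv_proj B hq p]
    exact hsub p
  refine ⟨A.chartedSpace, B.chartedSpace, ⟨A.isManifold, B.isManifold, ht2, hsc, A.contMDiff_val,
    ?_, A.contMDiff_proj B hq, hsub'⟩, B.reducedForm θ,
    ⟨A.isSymplecticForm_reducedForm B hsurj θ hθ hsub hnd,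
      A.pullback_proj_reducedForm B hq θ hθ⟩, ?_⟩
  · intro p
    rw [A.mfderiv_val p]
    exact A.inclDeriv_injective p
  · rintro τ ⟨-, hτ⟩
    exact SliceAtlas.twoForm_eq_of_pullback_eq hsurj hsub'
      (hτ.trans (A.pullback_proj_reducedForm B hq θ hθ).symm)

end SliceAtlas

/-! ### Smooth matrix operations and a local inverse square root. -/

section MatrixCalculus

open Topology Filter Set

variable {E : Type*} [NormedAddCommGroup E] [NormedSpace ℝ E] {k l m : ℕ} {n : ℕ∞ω} {x : E}

/-- Matrix multiplication as a continuous real-bilinear map. -/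
noncomputable def matMulL (k l m : ℕ) : Matrix (Fin k) (Fin l) ℂ →L[ℝ]
    Matrix (Fin l) (Fin m) ℂ →L[ℝ] Matrix (Fin k) (Fin m) ℂ :=
  (LinearMap.mk₂ ℝ (fun A B => A * B) (fun _ _ _ => Matrix.add_mul _ _ _)
    (fun _ _ _ => Matrix.smul_mul _ _ _) (fun _ _ _ => Matrix.mul_add _ _ _)
    (fun _ _ _ => Matrix.mul_smul _ _ _)).toContinuousBilinearMap

/-- The conjugate transpose as a continuous real-linear map. -/
noncomputable def conjTransposeL (k l : ℕ) :
    Matrix (Fin k) (Fin l) ℂ →L[ℝ] Matrix (Fin l) (Fin k) ℂ :=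
  LinearMap.toContinuousLinearMap
    { toFun := fun A => Aᴴ
      map_add' := Matrix.conjTranspose_add
      map_smul' := fun c A => by simp [Matrix.conjTranspose_smul] }

theorem _root_.ContDiffAt.matrix_mul {A : E → Matrix (Fin k) (Fin l) ℂ}
    {B : E → Matrix (Fin l) (Fin m) ℂ} (hA : ContDiffAt ℝ n A x) (hB : ContDiffAt ℝ n B x) :
    ContDiffAt ℝ n (fun y => A y * B y) x :=
  (matMulL k l m).isBoundedBilinearMap.contDiff.contDiffAt.comp x (hA.prodMk hB)

theorem _root_.ContDiffAt.matrix_conjTranspose {A : E → Matrix (Fin k) (Fin l) ℂ}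
    (hA : ContDiffAt ℝ n A x) : ContDiffAt ℝ n (fun y => (A y)ᴴ) x :=
  (conjTransposeL k l).contDiff.contDiffAt.comp x hA

/-- The derivative of a product of matrices. -/
noncomputable def mulDeriv (A : Matrix (Fin k) (Fin l) ℂ) (B : Matrix (Fin l) (Fin m) ℂ)
    (A' : E →L[ℝ] Matrix (Fin k) (Fin l) ℂ) (B' : E →L[ℝ] Matrix (Fin l) (Fin m) ℂ) :
    E →L[ℝ] Matrix (Fin k) (Fin m) ℂ :=
  (matMulL k l m).precompR E A B' + (matMulL k l m).precompL E A' B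

theorem _root_.HasFDerivAt.matrix_mul {A : E → Matrix (Fin k) (Fin l) ℂ}
    {B : E → Matrix (Fin l) (Fin m) ℂ} {A' : E →L[ℝ] Matrix (Fin k) (Fin l) ℂ}
    {B' : E →L[ℝ] Matrix (Fin l) (Fin m) ℂ} (hA : HasFDerivAt A A' x) (hB : HasFDerivAt B B' x) :
    HasFDerivAt (fun y => A y * B y) (mulDeriv (A x) (B x) A' B') x :=
  (matMulL k l m).hasFDerivAt_of_bilinear hA hB

theorem _root_.HasFDerivAt.matrix_conjTranspose {A : E → Matrix (Fin k) (Fin l) ℂ}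
    {A' : E →L[ℝ] Matrix (Fin k) (Fin l) ℂ} (hA : HasFDerivAt A A' x) :
    HasFDerivAt (fun y => (A y)ᴴ) (conjTransposeL k l ∘L A') x :=
  (conjTransposeL k l).hasFDerivAt.comp x hA

theorem contDiffAt_matrix {A : E → Matrix (Fin k) (Fin l) ℂ} :
    ContDiffAt ℝ n A x ↔ ∀ i j, ContDiffAt ℝ n (fun y => A y i j) x := by
  constructor
  · intro h i j
    exact contDiffAt_pi.1 (contDiffAt_pi.1 h i) j
  · intro h
    exact contDiffAt_pi.2 fun i => contDiffAt_pi.2 fun j => h i j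

theorem _root_.ContDiffAt.matrix_det {A : E → Matrix (Fin k) (Fin k) ℂ}
    (hA : ContDiffAt ℝ n A x) : ContDiffAt ℝ n (fun y => (A y).det) x := by
  simp only [Matrix.det_apply, Units.smul_def]
  refine ContDiffAt.sum fun σ _ => ?_
  have : ContDiffAt ℝ n (fun y => ∏ i, A y (σ i) i) x :=
    contDiffAt_prod fun i _ => contDiffAt_matrix.1 hA _ _
  simp only [zsmul_eq_mul]
  exact contDiffAt_const.mul this

/-- By Cramer's rule the inverse is det⁻¹ times the adjugate, whose entries are determinants. No
submultiplicative norm is involved. -/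
theorem _root_.ContDiffAt.matrix_inv {A : E → Matrix (Fin k) (Fin k) ℂ}
    (hA : ContDiffAt ℝ n A x) (h0 : (A x).det ≠ 0) : ContDiffAt ℝ n (fun y => (A y)⁻¹) x := by
  have hadj : ContDiffAt ℝ n (fun y => (A y).adjugate) x := by
    refine contDiffAt_matrix.2 fun i j => ?_
    simp only [Matrix.adjugate_apply]
    refine ContDiffAt.matrix_det (contDiffAt_matrix.2 fun a b => ?_)
    simp only [Matrix.updateRow_apply]
    split_ifs
    · exact contDiffAt_const
    · exact contDiffAt_matrix.1 hA _ _
  have h : ContDiffAt ℝ n (fun y => ((A y).det)⁻¹ • (A y).adjugate) x := by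
    refine contDiffAt_matrix.2 fun i j => ?_
    exact (hA.matrix_det.inv h0).mul (contDiffAt_matrix.1 hadj i j)
  simpa only [Matrix.inv_def, Ring.inverse_eq_inv'] using h

theorem eventually_det_ne_zero {Y : Type*} [TopologicalSpace Y] {x : Y}
    {A : Y → Matrix (Fin k) (Fin k) ℂ} (hA : ContinuousAt A x)
    (h0 : (A x).det ≠ 0) : ∀ᶠ y in 𝓝 x, (A y).det ≠ 0 := by
  have : ContinuousAt (fun y => (A y).det) x :=
    (Continuous.matrix_det continuous_id).continuousAt.comp hA
  exact this.eventually_ne h0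

theorem herm_coe (P : Herm k) : (P : Matrix (Fin k) (Fin k) ℂ)ᴴ = P := P.2

/-- The projection onto Hermitian matrices. -/
noncomputable def hermPart (k : ℕ) : Matrix (Fin k) (Fin k) ℂ →L[ℝ] Herm k :=
  LinearMap.toContinuousLinearMap (selfAdjointPart ℝ)

theorem hermPart_coe {A : Matrix (Fin k) (Fin k) ℂ} (hA : Aᴴ = A) :
    (hermPart k A : Matrix (Fin k) (Fin k) ℂ) = A :=
  IsSelfAdjoint.coe_selfAdjointPart_apply ℝ (x := A) hA

/-- Near the identity there is a smooth solution `R` of `R M R* = 1` for Hermitian `M`. -/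
theorem exists_smooth_inverse_sqrt (k : ℕ) :
    ∃ (O : Set (Matrix (Fin k) (Fin k) ℂ))
      (R : Matrix (Fin k) (Fin k) ℂ → Matrix (Fin k) (Fin k) ℂ),
      IsOpen O ∧ 1 ∈ O ∧ R 1 = 1 ∧ (∀ M ∈ O, ContDiffAt ℝ ∞ R M) ∧
      ∀ M ∈ O, Mᴴ = M → R M * M * (R M)ᴴ = 1 := by
  -- Squaring on Hermitian matrices has derivative 2 at the identity, so it is locally invertible
  -- there; R is the matrix inverse of the local square root.
  let f : Herm k → Herm k := fun P => hermPart k ((P : Matrix (Fin k) (Fin k) ℂ) * P)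
  have hfc : ∀ P, (f P : Matrix (Fin k) (Fin k) ℂ) = P * P := fun P =>
    hermPart_coe (by simp [Matrix.conjTranspose_mul, herm_coe P])
  let one : Herm k := ⟨1, by change (1 : Matrix (Fin k) (Fin k) ℂ)ᴴ = 1; simp⟩
  have hf1 : f one = one := by
    ext1; rw [hfc]; simp [one]
  -- Analyticity at a point spreads to a neighbourhood, whereas being C^∞ at a point does not; hence
  -- ω instead of ∞.
  have hcd : ContDiffAt ℝ ω f one := by
    have h1 : ContDiffAt ℝ ω (fun P : Herm k => (P : Matrix (Fin k) (Fin k) ℂ)) one :=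
      (Herm k).subtypeL.contDiff.contDiffAt
    exact (hermPart k).contDiff.contDiffAt.comp one (h1.matrix_mul h1)
  let e : Herm k ≃L[ℝ] Herm k := ContinuousLinearEquiv.smulLeft (Units.mk0 (2 : ℝ) two_ne_zero)
  have hfd : HasFDerivAt f (e : Herm k →L[ℝ] Herm k) one := by
    have h1 : HasFDerivAt (fun P : Herm k => (P : Matrix (Fin k) (Fin k) ℂ))
      (Herm k).subtypeL one := (Herm k).subtypeL.hasFDerivAt
    have h2 := (hermPart k).hasFDerivAt.comp one (h1.matrix_mul h1)
    refine h2.congr_fderiv ?_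
    ext1 P
    ext1
    have : (2 : ℝ) • (P : Matrix (Fin k) (Fin k) ℂ) = P + P := two_smul _ _
    change ((hermPart k ((1 : Matrix (Fin k) (Fin k) ℂ) * P + P * 1) : Herm k) :
      Matrix (Fin k) (Fin k) ℂ) = (2 : ℝ) • (P : Matrix (Fin k) (Fin k) ℂ)
    rw [Matrix.one_mul, Matrix.mul_one, hermPart_coe (by simp [herm_coe P]), this]
  let L := hcd.localInverse hfd (by simp)
  have hL : ContDiffAt ℝ ω L one := by
    have := hcd.to_localInverse hfd (by simp)
    rwa [hf1] at this
  have hL1 : L one = one := by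
    have := hcd.localInverse_apply_image hfd (by simp)
    rwa [hf1] at this
  have hright : ∀ᶠ M in 𝓝 one, f (L M) = M := by
    have := (hcd.hasStrictFDerivAt' hfd (by simp)).eventually_right_inverse
    rwa [hf1] at this
  have hdet : ∀ᶠ M in 𝓝 one, (L M : Matrix (Fin k) (Fin k) ℂ).det ≠ 0 := by
    refine eventually_det_ne_zero (A := fun M => (L M : Matrix (Fin k) (Fin k) ℂ))
      (continuous_subtype_val.continuousAt.comp hL.continuousAt) ?_
    rw [hL1]; simp [one]
  have hev := (hL.eventually (by simp)).and (hright.and hdet)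
  obtain ⟨O₁, hO₁, hO₁o, hO₁1⟩ := eventually_nhds_iff.1 hev
  have hp1 : hermPart k 1 = one := by ext1; exact hermPart_coe (by simp)
  refine ⟨hermPart k ⁻¹' O₁, fun M => (L (hermPart k M) : Matrix (Fin k) (Fin k) ℂ)⁻¹,
    hO₁o.preimage (hermPart k).continuous, ?_, ?_, ?_, ?_⟩
  · rw [mem_preimage, hp1]; exact hO₁1
  · simp only [hp1, hL1]; simp [one]
  · intro M hM
    have h := hO₁ _ hM
    have h1 : ContDiffAt ℝ ∞ (fun M => (L (hermPart k M) : Matrix (Fin k) (Fin k) ℂ)) M :=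
      (Herm k).subtypeL.contDiff.contDiffAt.comp M
        ((h.1.of_le le_top).comp M (hermPart k).contDiff.contDiffAt)
    exact h1.matrix_inv h.2.2
  · intro M hM hMh
    obtain ⟨-, h1, h2⟩ := hO₁ _ hM
    have h3 := congrArg (Subtype.val) h1
    rw [hfc, hermPart_coe hMh] at h3
    set P := (L (hermPart k M) : Matrix (Fin k) (Fin k) ℂ) with hP
    have hPh : Pᴴ = P := herm_coe _
    have hu : IsUnit P.det := isUnit_iff_ne_zero.2 h2
    change P⁻¹ * M * (P⁻¹)ᴴ = 1
    rw [Matrix.conjTranspose_nonsing_inv, hPh, ← h3, ← Matrix.mul_assoc,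
      Matrix.nonsing_inv_mul _ hu, Matrix.one_mul, Matrix.mul_nonsing_inv _ hu]

end MatrixCalculus

/-! ### The symplectic form, the isomorphism α, and the momentum map. -/

section Symplectic

open Topology Filter Set

variable {d N : ℕ}

theorem stdAlt_apply (X Y : Matrix (Fin d) (Fin N) ℂ) :
    stdAlt d N ![X, Y] = -(Matrix.trace (Yᴴ * X)).im := rfl

/-- ω(X, iX) = tr(X*X), the squared Frobenius norm. This positivity lies behind nondegeneracy of ω,
injectivity of α and nondegeneracy of the reduced form. -/
theorem eq_zero_of_stdAlt_I_smul {X : Matrix (Fin d) (Fin N) ℂ}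
    (h : stdAlt d N ![X, Complex.I • X] = 0) : X = 0 := by
  rw [stdAlt_apply, Matrix.conjTranspose_smul, Matrix.smul_mul, Matrix.trace_smul] at h
  simp at h
  have him : (Matrix.trace (Xᴴ * X)).im = 0 := by
    have := congrArg Complex.im (Matrix.trace_conjTranspose (Xᴴ * X))
    rw [Matrix.conjTranspose_mul, Matrix.conjTranspose_conjTranspose] at this
    simp only [Complex.star_def, Complex.conj_im] at this
    linarith
  exact Matrix.trace_conjTranspose_mul_self_eq_zero_iff.1 (Complex.ext h him)

theorem isSymplecticForm_const {E : Type*} [NormedAddCommGroup E] [NormedSpace ℝ E]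
    (θ : E [⋀^Fin 2]→L[ℝ] ℝ) (h : ∀ X, (∀ Y, θ ![X, Y] = 0) → X = 0) :
    IsSymplecticForm (fun _ => θ : VectorSpaceTwoForm E) := by
  have hc : ∀ e ∈ atlas E E,
      TwoForm.inChart (fun _ => θ : VectorSpaceTwoForm E) e = fun _ => θ := by
    intro e he
    rw [chartedSpaceSelf_atlas] at he
    subst he
    funext x
    ext v
    simp only [TwoForm.inChart, TwoForm.pullback]
    erw [mfderiv_id]
    rfl
  refine ⟨fun e he => ?_, fun e he x _ => ?_, fun p X hX => h X hX⟩
  · rw [hc e he]; exact contDiffOn_const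
  · rw [hc e he]
    ext v
    rw [extDeriv_apply (differentiableAt_const _)]
    simp

theorem pullback_const {E : Type*} [NormedAddCommGroup E] [NormedSpace ℝ E]
    (θ : E [⋀^Fin 2]→L[ℝ] ℝ) (L : E →L[ℝ] E) :
    TwoForm.pullback (fun p => L p) (fun _ => θ : VectorSpaceTwoForm E) =
      (fun _ => θ.compContinuousLinearMap L : VectorSpaceTwoForm E) := by
  funext p
  simp only [TwoForm.pullback, mfderiv_eq_fderiv]
  erw [L.fderiv]
  rfl

theorem isSymplecticForm_stdForm (d N : ℕ) : IsSymplecticForm (stdForm d N) :=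
  isSymplecticForm_const (stdAlt d N) fun X h =>
    eq_zero_of_stdAlt_I_smul (h (Complex.I • X))

theorem lieU_coe (ξ : LieU d) : (ξ : Matrix (Fin d) (Fin d) ℂ)ᴴ = -ξ := ξ.2

theorem alpha_apply (ξ : Herm d) (η : LieU d) : alpha d ξ η = (Complex.I / 2 *
    Matrix.trace ((η : Matrix (Fin d) (Fin d) ℂ)ᴴ * (ξ : Matrix (Fin d) (Fin d) ℂ))).re := rfl

theorem alpha_injective (d : ℕ) : Function.Injective (alpha d) := by
  refine (injective_iff_map_eq_zero _).2 fun ξ h => ?_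
  have hξ := herm_coe ξ
  -- Testing on η = iξ gives α_ξ(iξ) = ½ tr(ξ*ξ).
  let η : LieU d := ⟨Complex.I • (ξ : Matrix (Fin d) (Fin d) ℂ), by
    change _ᴴ = -_
    rw [Matrix.conjTranspose_smul, hξ]; simp⟩
  have h1 : alpha d ξ η = 0 := by rw [h]; rfl
  rw [alpha_apply] at h1
  simp only [η, Matrix.conjTranspose_smul, Matrix.smul_mul, Matrix.trace_smul] at h1
  have h2 : stdAlt d d ![(ξ : Matrix (Fin d) (Fin d) ℂ),
      Complex.I • (ξ : Matrix (Fin d) (Fin d) ℂ)] = 0 := by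
    rw [stdAlt_apply, Matrix.conjTranspose_smul, Matrix.smul_mul, Matrix.trace_smul]
    simp at h1 ⊢
    linarith
  exact Subtype.ext (eq_zero_of_stdAlt_I_smul h2)

/-- Multiplication by `i` identifies Hermitian and skew-Hermitian matrices. -/
noncomputable def hermEquivLieU (d : ℕ) : Herm d ≃ₗ[ℝ] LieU d where
  toFun ξ := ⟨Complex.I • (ξ : Matrix (Fin d) (Fin d) ℂ), by
    change _ᴴ = -_
    rw [Matrix.conjTranspose_smul, herm_coe ξ]; simp⟩
  invFun η := ⟨-Complex.I • (η : Matrix (Fin d) (Fin d) ℂ), by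
    change _ᴴ = _
    rw [Matrix.conjTranspose_smul, lieU_coe η]; simp⟩
  map_add' x y := by ext1; simp
  map_smul' c x := by ext1; exact smul_comm Complex.I c (x : Matrix (Fin d) (Fin d) ℂ)
  left_inv ξ := by ext1; simp [smul_smul]
  right_inv ξ := by ext1; simp [smul_smul]

theorem finrank_matrix (d N : ℕ) :
    Module.finrank ℝ (Matrix (Fin d) (Fin N) ℂ) = 2 * d * N := by
  rw [Module.finrank_matrix, Complex.finrank_real_complex]
  simp
  ring

/-- The 2d² real dimensions of the matrix space split into the Hermitian and skew-Hermitian parts,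
which multiplication by i identifies. -/
theorem finrank_herm (d : ℕ) : Module.finrank ℝ (Herm d) = d ^ 2 := by
  have h1 := (StarModule.decomposeProdAdjoint ℝ (Matrix (Fin d) (Fin d) ℂ)).finrank_eq
  have h2 := (hermEquivLieU d).finrank_eq
  have h3 : Module.finrank ℝ (Herm d × LieU d) = Module.finrank ℝ (Matrix (Fin d) (Fin d) ℂ) :=
    h1.symm
  rw [Module.finrank_prod, finrank_matrix, ← h2] at h3
  nlinarith

theorem finrank_lieU (d : ℕ) : Module.finrank ℝ (LieU d) = d ^ 2 := by
  rw [← (hermEquivLieU d).finrank_eq, finrank_herm]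

theorem alpha_bijective (d : ℕ) : Function.Bijective (alpha d) := by
  refine ⟨alpha_injective d, ?_⟩
  rw [← LinearMap.injective_iff_surjective_of_finrank_eq_finrank]
  · exact alpha_injective d
  · rw [Subspace.dual_finrank_eq, finrank_herm, finrank_lieU]

theorem smul_eq_mul_matrix (A : U d) (F : Matrix (Fin d) (Fin N) ℂ) :
    A • F = (A : Matrix (Fin d) (Fin d) ℂ) * F := rfl

theorem unitary_conjTranspose_mul (A : U d) :
    (A : Matrix (Fin d) (Fin d) ℂ)ᴴ * (A : Matrix (Fin d) (Fin d) ℂ) = 1 :=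
  Matrix.mem_unitaryGroup_iff'.1 A.2

theorem unitary_mul_conjTranspose (A : U d) :
    (A : Matrix (Fin d) (Fin d) ℂ) * (A : Matrix (Fin d) (Fin d) ℂ)ᴴ = 1 :=
  Matrix.mem_unitaryGroup_iff.1 A.2

theorem stdAlt_unitary_mul {A : Matrix (Fin d) (Fin d) ℂ} (hA : Aᴴ * A = 1)
    (X Y : Matrix (Fin d) (Fin N) ℂ) : stdAlt d N ![A * X, A * Y] = stdAlt d N ![X, Y] := by
  rw [stdAlt_apply, stdAlt_apply, Matrix.conjTranspose_mul, Matrix.mul_assoc, ← Matrix.mul_assoc Aᴴ,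
    hA, Matrix.one_mul]

/-- After applying a scalar functional, the conclusion no longer depends on the norm of 𝔸. So it can
be proved with an algebra norm on matrices and used where the elementwise norm is in force. -/
theorem hasDerivAt_linear_exp {𝔸 : Type*} [NormedRing 𝔸] [NormedAlgebra ℝ 𝔸]
    [FiniteDimensional ℝ 𝔸] (L : 𝔸 →ₗ[ℝ] ℂ) (ξ : 𝔸) :
    HasDerivAt (fun t : ℝ => L (NormedSpace.exp (t • ξ))) (L ξ) 0 := by
  have _ : CompleteSpace 𝔸 := FiniteDimensional.complete ℝ 𝔸
  have h := hasDerivAt_exp_smul_const (𝕂 := ℝ) ξ 0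
  simp only [zero_smul, NormedSpace.exp_zero, one_mul] at h
  exact L.toContinuousLinearMap.hasFDerivAt.comp_hasDerivAt 0 h

theorem hasDerivAt_exp_entry (ξ : Matrix (Fin d) (Fin d) ℂ) (i j : Fin d) :
    HasDerivAt (fun t : ℝ => NormedSpace.exp (t • ξ) i j) (ξ i j) 0 :=
  @hasDerivAt_linear_exp (Matrix (Fin d) (Fin d) ℂ) Matrix.linftyOpNormedRing
    Matrix.linftyOpNormedAlgebra inferInstance
    { toFun := fun M => M i j, map_add' := fun _ _ => rfl, map_smul' := fun _ _ => rfl } ξ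

theorem fundamentalField_eq (ξ : LieU d) (F : Matrix (Fin d) (Fin N) ℂ) :
    fundamentalField ξ F = (ξ : Matrix (Fin d) (Fin d) ℂ) * F := by
  refine HasDerivAt.deriv ?_
  refine hasDerivAt_pi.2 fun i => hasDerivAt_pi.2 fun j => ?_
  change HasDerivAt (fun t : ℝ => ∑ k, NormedSpace.exp (t • (ξ : Matrix (Fin d) (Fin d) ℂ)) i k *
    F k j) (∑ k, (ξ : Matrix (Fin d) (Fin d) ℂ) i k * F k j) 0
  exact HasDerivAt.fun_sum fun k _ => (hasDerivAt_exp_entry _ i k).mul_const _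

/-- The real-linear form `M ↦ Re ((i/2) tr (ξ* M))`. -/
noncomputable def pairingL (ξ : LieU d) : Matrix (Fin d) (Fin d) ℂ →L[ℝ] ℝ :=
  LinearMap.toContinuousLinearMap
    { toFun := fun M => (Complex.I / 2 *
        Matrix.trace ((ξ : Matrix (Fin d) (Fin d) ℂ)ᴴ * M)).re
      map_add' := by intros; simp [mul_add]
      map_smul' := by intros; simp; ring }

theorem pairingL_apply (ξ : LieU d) (M : Matrix (Fin d) (Fin d) ℂ) : pairingL ξ M =
    (Complex.I / 2 * Matrix.trace ((ξ : Matrix (Fin d) (Fin d) ℂ)ᴴ * M)).re := rfl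

theorem contDiff_gram (d N : ℕ) :
    ContDiff ℝ ∞ (fun F : Matrix (Fin d) (Fin N) ℂ => -(F * Fᴴ)) :=
  contDiff_iff_contDiffAt.2 fun _ =>
    (contDiffAt_id.matrix_mul contDiffAt_id.matrix_conjTranspose).neg

/-- The differential of `F ↦ -F F*`. -/
noncomputable def gramDeriv (F : Matrix (Fin d) (Fin N) ℂ) :
    Matrix (Fin d) (Fin N) ℂ →L[ℝ] Matrix (Fin d) (Fin d) ℂ :=
  -mulDeriv F Fᴴ (ContinuousLinearMap.id ℝ _) (conjTransposeL d N)

theorem gramDeriv_apply (F T : Matrix (Fin d) (Fin N) ℂ) :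
    gramDeriv F T = -(F * Tᴴ + T * Fᴴ) := rfl

theorem hasFDerivAt_gram (F : Matrix (Fin d) (Fin N) ℂ) :
    HasFDerivAt (fun F : Matrix (Fin d) (Fin N) ℂ => -(F * Fᴴ)) (gramDeriv F) F :=
  ((hasFDerivAt_id F).matrix_mul (conjTransposeL d N).hasFDerivAt).neg

/-- With z = tr(ξFY*), skewness of ξ gives tr(ξYF*) = -z̄. The two halves of dΦ therefore add up to
z - z̄ = 2i Im z, and the factor i/2 makes this -Im z. -/
theorem stdAlt_lie_mul (ξ : LieU d) (F Y : Matrix (Fin d) (Fin N) ℂ) :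
    stdAlt d N ![(ξ : Matrix (Fin d) (Fin d) ℂ) * F, Y] = pairingL ξ (gramDeriv F Y) := by
  rw [stdAlt_apply, pairingL_apply, gramDeriv_apply, lieU_coe]
  set z := Matrix.trace ((ξ : Matrix (Fin d) (Fin d) ℂ) * (F * Yᴴ)) with hz
  have h1 : Matrix.trace (Yᴴ * ((ξ : Matrix (Fin d) (Fin d) ℂ) * F)) = z := by
    rw [Matrix.trace_mul_comm, Matrix.mul_assoc]
  have h2 : Matrix.trace ((ξ : Matrix (Fin d) (Fin d) ℂ) * (Y * Fᴴ)) = -star z := by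
    rw [hz, ← Matrix.trace_conjTranspose, Matrix.conjTranspose_mul, Matrix.conjTranspose_mul,
      Matrix.conjTranspose_conjTranspose, lieU_coe, Matrix.mul_neg, Matrix.trace_neg, neg_neg,
      Matrix.trace_mul_comm]
  rw [h1, Matrix.neg_mul, Matrix.mul_neg, neg_neg, Matrix.mul_add, Matrix.trace_add, h2, ← hz]
  simp
  ring

theorem isMomentumMap_momentum (d N : ℕ) :
    IsMomentumMap (stdForm d N) (fun F => alpha d (momentum d N F)) where
  smooth_action := by
    refine ⟨fun x => x.1 * x.2, contDiff_iff_contDiffAt.2 fun x => ?_, fun A p => rfl⟩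
    exact contDiffAt_fst.matrix_mul contDiffAt_snd
  preserves_form A := by
    refine (pullback_const (stdAlt d N) (matMulL d d N (A : Matrix (Fin d) (Fin d) ℂ))).trans ?_
    funext p
    ext v
    exact stdAlt_unitary_mul (unitary_conjTranspose_mul A) (v 0) (v 1)
  smooth ξ := (pairingL ξ).contDiff.comp (contDiff_gram d N)
  hamilton ξ p Y := by
    have h : HasFDerivAt (fun q => alpha d (momentum d N q) ξ) (pairingL ξ ∘L gramDeriv p) p :=
      (pairingL ξ).hasFDerivAt.comp p (hasFDerivAt_gram p)
    have h2 := DFunLike.congr_fun h.fderiv Y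
    refine Eq.trans ?_ ((stdAlt_lie_mul ξ p Y).trans h2.symm)
    rw [fundamentalField_eq]
    rfl
  equivariant A F := by
    ext ξ
    change pairingL ξ (-((A : Matrix (Fin d) (Fin d) ℂ) * F *
      ((A : Matrix (Fin d) (Fin d) ℂ) * F)ᴴ)) = pairingL (adU A⁻¹ ξ) (-(F * Fᴴ))
    have h : ((adU A⁻¹ ξ : LieU d) : Matrix (Fin d) (Fin d) ℂ) =
        (A : Matrix (Fin d) (Fin d) ℂ)ᴴ * ξ * (A : Matrix (Fin d) (Fin d) ℂ) := by
      change (A : Matrix (Fin d) (Fin d) ℂ)ᴴ * ξ * ((A : Matrix (Fin d) (Fin d) ℂ)ᴴ)ᴴ = _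
      rw [Matrix.conjTranspose_conjTranspose]
    rw [pairingL_apply, pairingL_apply, lieU_coe, lieU_coe, h]
    congr 2
    simp only [Matrix.neg_mul, Matrix.mul_neg, neg_neg, Matrix.conjTranspose_mul, Matrix.mul_assoc]
    rw [Matrix.trace_mul_comm (A : Matrix (Fin d) (Fin d) ℂ)ᴴ]
    simp only [Matrix.mul_assoc]

end Symplectic

/-! ### Regular values of the momentum map; tight frames as a level set. -/

section RegularValues

open Topology Filter Set

variable {d N : ℕ}

theorem momentum_coe (F : Matrix (Fin d) (Fin N) ℂ) :
    (momentum d N F : Matrix (Fin d) (Fin d) ℂ) = -(F * Fᴴ) := rfl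

theorem fderiv_momentum_coe (F T : Matrix (Fin d) (Fin N) ℂ) :
    (fderiv ℝ (momentum d N) F T : Matrix (Fin d) (Fin d) ℂ) = -(F * Tᴴ + T * Fᴴ) := by
  have h0 : momentum d N = fun F => hermPart d (-(F * Fᴴ)) := by
    funext F
    ext1
    exact (hermPart_coe (herm_coe (momentum d N F))).symm
  have h1 : HasFDerivAt (momentum d N) (hermPart d ∘L gramDeriv F) F := by
    rw [h0]
    exact (hermPart d).hasFDerivAt.comp F (hasFDerivAt_gram F)
  rw [h1.fderiv]
  change ((hermPart d (-(F * Tᴴ + T * Fᴴ)) : Herm d) : Matrix (Fin d) (Fin d) ℂ) = _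
  exact hermPart_coe (by simp [Matrix.conjTranspose_mul, add_comm])

theorem fderiv_momentum_surjective {F : Matrix (Fin d) (Fin N) ℂ} (hF : IsUnit (F * Fᴴ).det) :
    Function.Surjective (fderiv ℝ (momentum d N) F) := by
  intro K
  have hK := herm_coe K
  set M := F * Fᴴ with hM
  -- For this T one has TF* = -½K, and FT* is its adjoint, again -½K.
  refine ⟨-(1 / 2 : ℝ) • ((K : Matrix (Fin d) (Fin d) ℂ) * M⁻¹ * F), ?_⟩
  ext1
  rw [fderiv_momentum_coe]
  have h1 : (K : Matrix (Fin d) (Fin d) ℂ) * M⁻¹ * F * Fᴴ = K := by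
    rw [Matrix.mul_assoc, ← hM, Matrix.mul_assoc, Matrix.nonsing_inv_mul _ hF, Matrix.mul_one]
  have h2 : F * ((K : Matrix (Fin d) (Fin d) ℂ) * M⁻¹ * F)ᴴ = K := by
    have := congrArg Matrix.conjTranspose h1
    rwa [Matrix.conjTranspose_mul _ Fᴴ, Matrix.conjTranspose_conjTranspose, hK] at this
  rw [Matrix.conjTranspose_smul, Matrix.mul_smul, Matrix.smul_mul, h1, h2, star_trivial,
    ← add_smul, ← neg_smul]
  norm_num

theorem exists_mul_conjTranspose_eq_one (hdN : d ≤ N) :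
    ∃ J : Matrix (Fin d) (Fin N) ℂ, J * Jᴴ = 1 := by
  refine ⟨Matrix.of fun i j => if Fin.castLE hdN i = j then 1 else 0, ?_⟩
  ext i j
  simp [Matrix.mul_apply, Matrix.one_apply, eq_comm (a := i)]

open scoped MatrixOrder in
theorem exists_eq_conjTranspose_mul_self {M : Matrix (Fin d) (Fin d) ℂ} (hM : M.PosSemidef) :
    ∃ B : Matrix (Fin d) (Fin d) ℂ, M = Bᴴ * B := by
  obtain ⟨X, hX, -, h⟩ := CFC.exists_sqrt_of_isSelfAdjoint_of_quasispectrumRestricts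
    hM.isHermitian (QuasispectrumRestricts.nnreal_of_nonneg hM.nonneg)
  refine ⟨X, ?_⟩
  have hX' : Xᴴ = X := hX
  rw [hX', ← h]

theorem isRegularValue_momentum_iff (hdN : d ≤ N) (χ : Herm d) :
    IsRegularValue (momentum d N) χ ↔ (-(χ : Matrix (Fin d) (Fin d) ℂ)).PosDef := by
  constructor
  · rintro ⟨⟨F, rfl⟩, h⟩
    -- Take a preimage T of the identity. If vF = 0, pairing 1 = -(FT* + TF*) with v and its
    -- conjugate kills both terms, so v = 0.
    obtain ⟨T, hT⟩ := h F rfl ⟨1, by change (1 : Matrix (Fin d) (Fin d) ℂ)ᴴ = 1; simp⟩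
    have hT' := (fderiv_momentum_coe F T).symm.trans (congrArg Subtype.val hT)
    rw [momentum_coe, neg_neg]
    refine Matrix.PosDef.mul_conjTranspose_self F ?_
    refine (injective_iff_map_eq_zero (Matrix.vecMulLinear F)).2 fun v hv => ?_
    replace hv : v ᵥ* F = 0 := hv
    have h2 : Fᴴ *ᵥ (star v) = 0 := by
      rw [← Matrix.star_vecMul, hv, star_zero]
    have h3 : v ⬝ᵥ ((1 : Matrix (Fin d) (Fin d) ℂ) *ᵥ star v) = 0 := by
      have hT2 : (1 : Matrix (Fin d) (Fin d) ℂ) = -(F * Tᴴ + T * Fᴴ) := hT'.symm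
      rw [hT2, Matrix.neg_mulVec, Matrix.add_mulVec, ← Matrix.mulVec_mulVec, ← Matrix.mulVec_mulVec,
        h2, Matrix.mulVec_zero, add_zero, dotProduct_neg, Matrix.dotProduct_mulVec, hv,
        zero_dotProduct, neg_zero]
    rw [Matrix.one_mulVec] at h3
    rwa [dotProduct_comm, dotProduct_star_self_eq_zero] at h3
  · intro h
    constructor
    -- With -χ = B*B and JJ* = 1, the matrix B*J lies over χ; the existence of J uses d ≤ N.
    · obtain ⟨J, hJ⟩ := exists_mul_conjTranspose_eq_one hdN
      obtain ⟨B, hB⟩ := exists_eq_conjTranspose_mul_self h.posSemidef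
      refine ⟨Bᴴ * J, ?_⟩
      ext1
      rw [momentum_coe, Matrix.conjTranspose_mul, Matrix.conjTranspose_conjTranspose,
        Matrix.mul_assoc, ← Matrix.mul_assoc J, hJ, Matrix.one_mul, ← hB, neg_neg]
    · rintro F rfl
      rw [momentum_coe, neg_neg] at h
      exact fderiv_momentum_surjective (isUnit_iff_ne_zero.2 h.det_pos.ne')

theorem sum_norm_inner_sq (F : Matrix (Fin d) (Fin N) ℂ) (v : EuclideanSpace ℂ (Fin d)) :
    ((∑ i, ‖inner ℂ v (WithLp.toLp 2 (fun k => F k i))‖ ^ 2 : ℝ) : ℂ) =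
      inner ℂ (Matrix.toEuclideanLin (F * Fᴴ) v) v := by
  set u : Fin N → ℂ := Fᴴ *ᵥ v.ofLp with hu
  have h1 : inner ℂ (Matrix.toEuclideanLin (F * Fᴴ) v) v = star u ⬝ᵥ u := by
    rw [EuclideanSpace.inner_eq_star_dotProduct, Matrix.ofLp_toLpLin,
      Matrix.toLin'_apply, ← Matrix.mulVec_mulVec, ← hu, Matrix.star_mulVec, dotProduct_comm,
      ← Matrix.dotProduct_mulVec]
  rw [h1, dotProduct]
  push_cast
  refine Finset.sum_congr rfl fun i _ => ?_
  have h2 : inner ℂ v (WithLp.toLp 2 (fun k => F k i)) = star (u i) := by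
    rw [EuclideanSpace.inner_eq_star_dotProduct, hu, Matrix.mulVec, dotProduct, dotProduct,
      star_sum]
    refine Finset.sum_congr rfl fun k _ => ?_
    simp
  rw [h2, norm_star, Pi.star_apply, Complex.star_def, Complex.conj_mul']

/-- The sum in the frame condition is the quadratic form of FF*, and over ℂ an operator is
determined by its quadratic form. -/
theorem mem_tightFrames_iff {c : ℝ} (hc : 0 < c) {F : Matrix (Fin d) (Fin N) ℂ} :
    F ∈ tightFrames d N c ↔ F * Fᴴ = c • (1 : Matrix (Fin d) (Fin d) ℂ) := by
  have h1 : F ∈ tightFrames d N c ↔ ∀ v : EuclideanSpace ℂ (Fin d),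
      ((∑ i, ‖inner ℂ v (WithLp.toLp 2 (fun k => F k i))‖ ^ 2 : ℝ) : ℂ) =
        ((c * ‖v‖ ^ 2 : ℝ) : ℂ) := by
    constructor
    · intro h v
      exact congrArg _ (le_antisymm (h.2.2 v).2 (h.2.2 v).1)
    · intro h
      exact ⟨hc, le_rfl, fun v => ⟨(Complex.ofReal_injective (h v)).ge,
        (Complex.ofReal_injective (h v)).le⟩⟩
  rw [h1]
  have h2 : ∀ v : EuclideanSpace ℂ (Fin d), ((c * ‖v‖ ^ 2 : ℝ) : ℂ) =
      inner ℂ (Matrix.toEuclideanLin (c • (1 : Matrix (Fin d) (Fin d) ℂ)) v) v := by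
    intro v
    have h3 : Matrix.toEuclideanLin (c • (1 : Matrix (Fin d) (Fin d) ℂ)) v = (c : ℂ) • v := by
      ext i
      simp [Matrix.smul_mulVec]
    rw [h3, inner_smul_left, inner_self_eq_norm_sq_to_K]
    simp
  simp only [sum_norm_inner_sq, h2]
  constructor
  · intro h
    have := (ext_inner_map _ _).1 h
    exact Matrix.toEuclideanLin.injective this
  · intro h v
    rw [h]

theorem tightFrames_eq_level {c : ℝ} (hc : 0 < c) : tightFrames d N c =
    {F | (momentum d N F : Matrix (Fin d) (Fin d) ℂ) = -(c • 1)} := by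
  ext F
  rw [mem_tightFrames_iff hc, mem_ofPred_eq, momentum_coe, neg_inj]

theorem smul_mem_tightFrames {c : ℝ} (hc : 0 < c) (A : U d) {F : Matrix (Fin d) (Fin N) ℂ}
    (hF : F ∈ tightFrames d N c) : A • F ∈ tightFrames d N c := by
  rw [mem_tightFrames_iff hc] at hF ⊢
  rw [smul_eq_mul_matrix, Matrix.conjTranspose_mul, Matrix.mul_assoc, ← Matrix.mul_assoc F, hF,
    Matrix.smul_mul, Matrix.one_mul, Matrix.mul_smul, unitary_mul_conjTranspose]

/-- Multiplying AF = F on the right by F* gives cA = c. -/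
theorem eq_one_of_smul_eq {c : ℝ} (hc : 0 < c) (A : U d) {F : Matrix (Fin d) (Fin N) ℂ}
    (hF : F ∈ tightFrames d N c) (h : A • F = F) : A = 1 := by
  rw [mem_tightFrames_iff hc] at hF
  have h1 : (A : Matrix (Fin d) (Fin d) ℂ) * (F * Fᴴ) = F * Fᴴ := by
    rw [← Matrix.mul_assoc, ← smul_eq_mul_matrix, h]
  rw [hF, Matrix.mul_smul, Matrix.mul_one] at h1
  exact Subtype.ext (smul_right_injective _ hc.ne' h1)

end RegularValues

/-! ### The Cayley transform between skew-Hermitian and unitary matrices. -/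

section Cayley

variable {d : ℕ}

/-- The Cayley transform `x ↦ (1 - x) (1 + x)⁻¹`. -/
noncomputable def cayley (x : Matrix (Fin d) (Fin d) ℂ) : Matrix (Fin d) (Fin d) ℂ :=
  (1 - x) * (1 + x)⁻¹

variable {x : Matrix (Fin d) (Fin d) ℂ}

theorem one_add_cayley (h : (1 + x).det ≠ 0) : 1 + cayley x = (2 : ℂ) • (1 + x)⁻¹ := by
  have hu : IsUnit (1 + x).det := isUnit_iff_ne_zero.2 h
  calc 1 + cayley x = (1 + x) * (1 + x)⁻¹ + (1 - x) * (1 + x)⁻¹ := by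
        rw [Matrix.mul_nonsing_inv _ hu, cayley]
    _ = ((1 + x) + (1 - x)) * (1 + x)⁻¹ := (add_mul _ _ _).symm
    _ = (2 : ℂ) • (1 + x)⁻¹ := by
        have : (1 + x) + (1 - x) = (2 : ℂ) • (1 : Matrix (Fin d) (Fin d) ℂ) := by
          rw [two_smul]; abel
        rw [this, Matrix.smul_mul, Matrix.one_mul]

theorem one_sub_cayley (h : (1 + x).det ≠ 0) : 1 - cayley x = (2 : ℂ) • (x * (1 + x)⁻¹) := by
  have hu : IsUnit (1 + x).det := isUnit_iff_ne_zero.2 h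
  calc 1 - cayley x = (1 + x) * (1 + x)⁻¹ - (1 - x) * (1 + x)⁻¹ := by
        rw [Matrix.mul_nonsing_inv _ hu, cayley]
    _ = ((1 + x) - (1 - x)) * (1 + x)⁻¹ := (sub_mul _ _ _).symm
    _ = (2 : ℂ) • (x * (1 + x)⁻¹) := by
        have : (1 + x) - (1 - x) = (2 : ℂ) • x := by rw [two_smul]; abel
        rw [this, Matrix.smul_mul]

theorem det_one_add_cayley (h : (1 + x).det ≠ 0) : (1 + cayley x).det ≠ 0 := by
  rw [one_add_cayley h, Matrix.det_smul, Matrix.det_nonsing_inv, Ring.inverse_eq_inv']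
  exact mul_ne_zero (pow_ne_zero _ two_ne_zero) (inv_ne_zero h)

/-- The numerator and denominator of the second transform are 2x(1+x)⁻¹ and 2(1+x)⁻¹. Being an
involution, the transform serves as both a chart and its inverse. -/
theorem cayley_cayley (h : (1 + x).det ≠ 0) : cayley (cayley x) = x := by
  have hu : IsUnit (1 + x).det := isUnit_iff_ne_zero.2 h
  have hinv : ((2 : ℂ) • (1 + x)⁻¹)⁻¹ = (2⁻¹ : ℂ) • (1 + x) := by
    refine Matrix.inv_eq_right_inv ?_
    rw [Matrix.smul_mul, Matrix.mul_smul, Matrix.nonsing_inv_mul _ hu, smul_smul]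
    simp
  rw [cayley, one_add_cayley h, one_sub_cayley h, hinv, Matrix.smul_mul, Matrix.mul_smul,
    Matrix.mul_assoc, Matrix.nonsing_inv_mul _ hu, smul_smul]
  simp

/-- For skew x the matrices 1 + x and 1 - x are adjoint to each other and commute. -/
theorem cayley_mul_conjTranspose (hx : xᴴ = -x) (h : (1 + x).det ≠ 0) :
    cayley x * (cayley x)ᴴ = 1 := by
  have hu : IsUnit (1 + x).det := isUnit_iff_ne_zero.2 h
  have hs : (1 + x)ᴴ = 1 - x := by rw [Matrix.conjTranspose_add, hx]; simp [sub_eq_add_neg]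
  have hs' : (1 - x)ᴴ = 1 + x := by rw [← hs, Matrix.conjTranspose_conjTranspose]
  have hu' : IsUnit (1 - x).det := by
    rw [← hs, Matrix.det_conjTranspose]; exact hu.star
  have hcomm : (1 + x)⁻¹ * (1 - x)⁻¹ = (1 - x)⁻¹ * (1 + x)⁻¹ := by
    rw [← Matrix.mul_inv_rev, ← Matrix.mul_inv_rev]
    congr 1
    noncomm_ring
  rw [cayley, Matrix.conjTranspose_mul, Matrix.conjTranspose_nonsing_inv, hs, hs',
    Matrix.mul_assoc, ← Matrix.mul_assoc (1 + x)⁻¹, hcomm, Matrix.mul_assoc,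
    Matrix.nonsing_inv_mul _ hu, Matrix.mul_one, Matrix.mul_nonsing_inv _ hu']

theorem conjTranspose_cayley (hx : x * xᴴ = 1) (h : (1 + x).det ≠ 0) :
    (cayley x)ᴴ = -cayley x := by
  have hu : IsUnit (1 + x).det := isUnit_iff_ne_zero.2 h
  have h1 : (1 + x)ᴴ = xᴴ * (1 + x) := by
    rw [Matrix.mul_add, mul_eq_one_comm.1 hx]; simp [add_comm]
  have hxinv : (xᴴ)⁻¹ = x := Matrix.inv_eq_left_inv hx
  have hcomm : (1 + x)⁻¹ * (x - 1) = (x - 1) * (1 + x)⁻¹ := by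
    have h2 : (1 + x) * (x - 1) = (x - 1) * (1 + x) := by noncomm_ring
    calc (1 + x)⁻¹ * (x - 1) = (1 + x)⁻¹ * ((x - 1) * (1 + x)) * (1 + x)⁻¹ := by
          rw [← Matrix.mul_assoc, Matrix.mul_assoc _ (1 + x), Matrix.mul_nonsing_inv _ hu,
            Matrix.mul_one]
      _ = (x - 1) * (1 + x)⁻¹ := by
          rw [← h2, ← Matrix.mul_assoc, Matrix.nonsing_inv_mul _ hu, Matrix.one_mul]
  rw [cayley, Matrix.conjTranspose_mul, Matrix.conjTranspose_nonsing_inv, h1, Matrix.mul_inv_rev,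
    hxinv, Matrix.mul_assoc, Matrix.conjTranspose_sub, Matrix.conjTranspose_one, mul_sub, hx,
    Matrix.mul_one, hcomm, ← Matrix.neg_mul, neg_sub]

theorem _root_.ContDiffAt.cayley {E : Type*} [NormedAddCommGroup E] [NormedSpace ℝ E] {n : ℕ∞ω}
    {f : E → Matrix (Fin d) (Fin d) ℂ} {y : E} (hf : ContDiffAt ℝ n f y)
    (h : (1 + f y).det ≠ 0) : ContDiffAt ℝ n (fun z => FrameReduction.cayley (f z)) y :=
  (contDiffAt_const.sub hf).matrix_mul ((contDiffAt_const.add hf).matrix_inv h)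

end Cayley

/-! ### Affine coordinates of row spaces and smooth tight-frame sections. -/

section LocalSections

open Topology Filter Set

variable {d N : ℕ}

/-- A neighbourhood of the identity on which `invSqrt` is smooth. -/
noncomputable def sqrtDom (d : ℕ) : Set (Matrix (Fin d) (Fin d) ℂ) :=
  (exists_smooth_inverse_sqrt d).choose

/-- A smooth inverse square root of Hermitian matrices, near the identity. -/
noncomputable def invSqrt (d : ℕ) : Matrix (Fin d) (Fin d) ℂ → Matrix (Fin d) (Fin d) ℂ :=
  (exists_smooth_inverse_sqrt d).choose_spec.choose

theorem invSqrt_spec (d : ℕ) : IsOpen (sqrtDom d) ∧ 1 ∈ sqrtDom d ∧ invSqrt d 1 = 1 ∧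
    (∀ M ∈ sqrtDom d, ContDiffAt ℝ ∞ (invSqrt d) M) ∧
    ∀ M ∈ sqrtDom d, Mᴴ = M → invSqrt d M * M * (invSqrt d M)ᴴ = 1 :=
  (exists_smooth_inverse_sqrt d).choose_spec.choose_spec

/-- The matrix in the `GL(d)`-orbit of `F` whose product with `F₀*` is the identity. -/
noncomputable def normalized (F₀ F : Matrix (Fin d) (Fin N) ℂ) : Matrix (Fin d) (Fin N) ℂ :=
  (F * F₀ᴴ)⁻¹ * F

/-- The affine coordinate of the row space of `F`, relative to `F₀`. -/
noncomputable def affineCoord (c : ℝ) (F₀ F : Matrix (Fin d) (Fin N) ℂ) :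
    Matrix (Fin d) (Fin N) ℂ :=
  normalized F₀ F - c⁻¹ • F₀

/-- The matrix `c G G*`, where `G = F₀ / c + Y`. -/
noncomputable def scaledGram (c : ℝ) (F₀ Y : Matrix (Fin d) (Fin N) ℂ) :
    Matrix (Fin d) (Fin d) ℂ :=
  c • ((c⁻¹ • F₀ + Y) * (c⁻¹ • F₀ + Y)ᴴ)

/-- The tight frame with the same row space as `F₀ / c + Y`. -/
noncomputable def frameSection (c : ℝ) (F₀ Y : Matrix (Fin d) (Fin N) ℂ) :
    Matrix (Fin d) (Fin N) ℂ :=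
  c • (invSqrt d (scaledGram c F₀ Y) * (c⁻¹ • F₀ + Y))

/-- The domain of the affine coordinate. -/
def coordDom (c : ℝ) (F₀ : Matrix (Fin d) (Fin N) ℂ) : Set (Matrix (Fin d) (Fin N) ℂ) :=
  {F | (F * F₀ᴴ).det ≠ 0 ∧ scaledGram c F₀ (affineCoord c F₀ F) ∈ sqrtDom d}

variable {c : ℝ} {F₀ F Y : Matrix (Fin d) (Fin N) ℂ}

theorem scaledGram_conjTranspose (c : ℝ) (F₀ Y : Matrix (Fin d) (Fin N) ℂ) :
    (scaledGram c F₀ Y)ᴴ = scaledGram c F₀ Y := by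
  simp [scaledGram, Matrix.conjTranspose_smul, Matrix.conjTranspose_mul]

theorem add_affineCoord (c : ℝ) (F₀ F : Matrix (Fin d) (Fin N) ℂ) :
    c⁻¹ • F₀ + affineCoord c F₀ F = normalized F₀ F := by
  rw [affineCoord]; abel

theorem affineCoord_add (h : normalized F₀ F = c⁻¹ • F₀ + Y) : affineCoord c F₀ F = Y := by
  rw [affineCoord, h]; abel

theorem normalized_mul (hF : (F * F₀ᴴ).det ≠ 0) : normalized F₀ F * F₀ᴴ = 1 := by
  rw [normalized, Matrix.mul_assoc, Matrix.nonsing_inv_mul _ (isUnit_iff_ne_zero.2 hF)]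

/-- The prefactor (FF₀*)⁻¹ absorbs any invertible A. Invariance under all of GL(d), not only U(d),
is needed later for curves that leave the level set. -/
theorem normalized_left_mul {A : Matrix (Fin d) (Fin d) ℂ} (hA : A.det ≠ 0) :
    normalized F₀ (A * F) = normalized F₀ F := by
  rw [normalized, Matrix.mul_assoc A, Matrix.mul_inv_rev, Matrix.mul_assoc, ← Matrix.mul_assoc A⁻¹,
    Matrix.nonsing_inv_mul _ (isUnit_iff_ne_zero.2 hA), Matrix.one_mul, normalized]

theorem affineCoord_left_mul {A : Matrix (Fin d) (Fin d) ℂ} (hA : A.det ≠ 0) :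
    affineCoord c F₀ (A * F) = affineCoord c F₀ F := by
  rw [affineCoord, normalized_left_mul hA, affineCoord]

theorem left_mul_mem_coordDom {A : Matrix (Fin d) (Fin d) ℂ} (hA : A.det ≠ 0)
    (hF : F ∈ coordDom c F₀) : A * F ∈ coordDom c F₀ := by
  refine ⟨?_, by rw [affineCoord_left_mul hA]; exact hF.2⟩
  rw [Matrix.mul_assoc, Matrix.det_mul]
  exact mul_ne_zero hA hF.1

theorem base_mul (hc : 0 < c) (hF₀ : F₀ * F₀ᴴ = c • (1 : Matrix (Fin d) (Fin d) ℂ)) :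
    c⁻¹ • F₀ * F₀ᴴ = 1 := by
  rw [Matrix.smul_mul, hF₀, smul_smul, inv_mul_cancel₀ hc.ne', one_smul]

theorem affineCoord_mul (hc : 0 < c) (hF₀ : F₀ * F₀ᴴ = c • (1 : Matrix (Fin d) (Fin d) ℂ))
    (hF : (F * F₀ᴴ).det ≠ 0) : affineCoord c F₀ F * F₀ᴴ = 0 := by
  rw [affineCoord, Matrix.sub_mul, normalized_mul hF, base_mul hc hF₀, sub_self]

theorem affineCoord_self (hc : 0 < c) (hF₀ : F₀ * F₀ᴴ = c • (1 : Matrix (Fin d) (Fin d) ℂ)) :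
    affineCoord c F₀ F₀ = 0 := by
  have : (c • (1 : Matrix (Fin d) (Fin d) ℂ))⁻¹ = c⁻¹ • 1 := by
    refine Matrix.inv_eq_right_inv ?_
    rw [Matrix.smul_mul, Matrix.one_mul, smul_smul, mul_inv_cancel₀ hc.ne', one_smul]
  rw [affineCoord, normalized, hF₀, this, Matrix.smul_mul, Matrix.one_mul, sub_self]

theorem scaledGram_zero (hc : 0 < c) (hF₀ : F₀ * F₀ᴴ = c • (1 : Matrix (Fin d) (Fin d) ℂ)) :
    scaledGram c F₀ 0 = 1 := by
  rw [scaledGram, add_zero, Matrix.conjTranspose_smul, Matrix.mul_smul, base_mul hc hF₀,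
    star_trivial, smul_smul, mul_inv_cancel₀ hc.ne', one_smul]

theorem frameSection_zero (hc : 0 < c) (hF₀ : F₀ * F₀ᴴ = c • (1 : Matrix (Fin d) (Fin d) ℂ)) :
    frameSection c F₀ 0 = F₀ := by
  rw [frameSection, scaledGram_zero hc hF₀, (invSqrt_spec d).2.2.1, Matrix.one_mul, add_zero,
    smul_smul, mul_inv_cancel₀ hc.ne', one_smul]

theorem det_smul_one_ne_zero (hc : 0 < c) : (c • (1 : Matrix (Fin d) (Fin d) ℂ)).det ≠ 0 := by
  have h : (c • (1 : Matrix (Fin d) (Fin d) ℂ)) * (c⁻¹ • 1) = 1 := by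
    rw [Matrix.smul_mul, Matrix.one_mul, smul_smul, mul_inv_cancel₀ hc.ne', one_smul]
  intro h0
  have := congrArg Matrix.det h
  rw [Matrix.det_mul, h0, zero_mul, Matrix.det_one] at this
  exact zero_ne_one this

theorem self_mem_coordDom (hc : 0 < c)
    (hF₀ : F₀ * F₀ᴴ = c • (1 : Matrix (Fin d) (Fin d) ℂ)) : F₀ ∈ coordDom c F₀ := by
  refine ⟨?_, ?_⟩
  · rw [hF₀]; exact det_smul_one_ne_zero hc
  · rw [affineCoord_self hc hF₀, scaledGram_zero hc hF₀]
    exact (invSqrt_spec d).2.1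

/-- R(cGG*)R* = 1, so cRG has frame operator c. The scaling makes the Gram matrix equal to 1 at Y =
0, where the inverse square root is centred. -/
theorem frameSection_mul_conjTranspose (hY : scaledGram c F₀ Y ∈ sqrtDom d) :
    frameSection c F₀ Y * (frameSection c F₀ Y)ᴴ = c • (1 : Matrix (Fin d) (Fin d) ℂ) := by
  have h := (invSqrt_spec d).2.2.2.2 _ hY (scaledGram_conjTranspose c F₀ Y)
  set R := invSqrt d (scaledGram c F₀ Y) with hR
  set G := c⁻¹ • F₀ + Y with hG
  have h1 : frameSection c F₀ Y = c • (R * G) := rfl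
  have h2 : scaledGram c F₀ Y = c • (G * Gᴴ) := rfl
  rw [h2, Matrix.mul_smul, Matrix.smul_mul] at h
  rw [h1, Matrix.conjTranspose_smul, Matrix.conjTranspose_mul, Matrix.smul_mul, Matrix.mul_smul,
    star_trivial, Matrix.mul_assoc R, ← Matrix.mul_assoc G, ← Matrix.mul_assoc R, h]

theorem det_invSqrt_ne_zero (hY : scaledGram c F₀ Y ∈ sqrtDom d) :
    (invSqrt d (scaledGram c F₀ Y)).det ≠ 0 := by
  have h := (invSqrt_spec d).2.2.2.2 _ hY (scaledGram_conjTranspose c F₀ Y)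
  intro h0
  have := congrArg Matrix.det h
  rw [Matrix.det_mul, Matrix.det_mul, h0, zero_mul, zero_mul, Matrix.det_one] at this
  exact zero_ne_one this

theorem det_smul_invSqrt_ne_zero (hc : 0 < c) (hY : scaledGram c F₀ Y ∈ sqrtDom d) :
    (c • invSqrt d (scaledGram c F₀ Y)).det ≠ 0 := by
  have h : c • invSqrt d (scaledGram c F₀ Y) =
      (c • (1 : Matrix (Fin d) (Fin d) ℂ)) * invSqrt d (scaledGram c F₀ Y) := by
    rw [Matrix.smul_mul, Matrix.one_mul]
  rw [h, Matrix.det_mul]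
  exact mul_ne_zero (det_smul_one_ne_zero hc) (det_invSqrt_ne_zero hY)

/-- The section is an invertible multiple of G = F₀/c + Y, and GF₀* = 1 already holds. -/
theorem normalized_frameSection (hc : 0 < c)
    (hF₀ : F₀ * F₀ᴴ = c • (1 : Matrix (Fin d) (Fin d) ℂ)) (hY0 : Y * F₀ᴴ = 0)
    (hY : scaledGram c F₀ Y ∈ sqrtDom d) :
    normalized F₀ (frameSection c F₀ Y) = c⁻¹ • F₀ + Y := by
  have h1 : frameSection c F₀ Y = (c • invSqrt d (scaledGram c F₀ Y)) * (c⁻¹ • F₀ + Y) := by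
    rw [frameSection, Matrix.smul_mul]
  rw [h1, normalized_left_mul (det_smul_invSqrt_ne_zero hc hY), normalized, Matrix.add_mul,
    base_mul hc hF₀, hY0, add_zero, inv_one, Matrix.one_mul]

theorem affineCoord_frameSection (hc : 0 < c)
    (hF₀ : F₀ * F₀ᴴ = c • (1 : Matrix (Fin d) (Fin d) ℂ)) (hY0 : Y * F₀ᴴ = 0)
    (hY : scaledGram c F₀ Y ∈ sqrtDom d) : affineCoord c F₀ (frameSection c F₀ Y) = Y :=
  affineCoord_add (normalized_frameSection hc hF₀ hY0 hY)

theorem frameSection_mem_coordDom (hc : 0 < c)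
    (hF₀ : F₀ * F₀ᴴ = c • (1 : Matrix (Fin d) (Fin d) ℂ)) (hY0 : Y * F₀ᴴ = 0)
    (hY : scaledGram c F₀ Y ∈ sqrtDom d) : frameSection c F₀ Y ∈ coordDom c F₀ := by
  refine ⟨?_, by rwa [affineCoord_frameSection hc hF₀ hY0 hY]⟩
  have h1 : frameSection c F₀ Y * F₀ᴴ = c • invSqrt d (scaledGram c F₀ Y) := by
    rw [frameSection, Matrix.smul_mul, Matrix.mul_assoc, Matrix.add_mul, base_mul hc hF₀, hY0,
      add_zero, Matrix.mul_one]
  rw [h1]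
  exact det_smul_invSqrt_ne_zero hc hY

/-- Tight frames in the same `GL(d)`-orbit are related by a unitary matrix. -/
theorem exists_unitary_of_left_mul (hc : 0 < c) {F' : Matrix (Fin d) (Fin N) ℂ}
    (hF : F * Fᴴ = c • (1 : Matrix (Fin d) (Fin d) ℂ))
    (hF' : F' * F'ᴴ = c • (1 : Matrix (Fin d) (Fin d) ℂ)) {k : Matrix (Fin d) (Fin d) ℂ}
    (h : F' = k * F) : ∃ A : U d, F' = A • F := by
  have hk : k * kᴴ = 1 := by
    rw [h, Matrix.conjTranspose_mul, Matrix.mul_assoc, ← Matrix.mul_assoc F, hF, Matrix.smul_mul,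
      Matrix.one_mul, Matrix.mul_smul] at hF'
    exact smul_right_injective _ hc.ne' hF'
  exact ⟨⟨k, Matrix.mem_unitaryGroup_iff.2 hk⟩, h⟩

theorem exists_unitary_frameSection (hc : 0 < c)
    (hF : F * Fᴴ = c • (1 : Matrix (Fin d) (Fin d) ℂ)) (hd : F ∈ coordDom c F₀) :
    ∃ A : U d, frameSection c F₀ (affineCoord c F₀ F) = A • F := by
  refine exists_unitary_of_left_mul hc hF (frameSection_mul_conjTranspose hd.2)
    (k := c • (invSqrt d (scaledGram c F₀ (affineCoord c F₀ F)) * (F * F₀ᴴ)⁻¹)) ?_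
  rw [frameSection, add_affineCoord, normalized, Matrix.smul_mul, Matrix.mul_assoc]

/-- Two tight frames are in the same orbit if and only if they have the same Gram matrix. -/
theorem exists_unitary_iff (hc : 0 < c) {F' : Matrix (Fin d) (Fin N) ℂ}
    (hF : F * Fᴴ = c • (1 : Matrix (Fin d) (Fin d) ℂ))
    (hF' : F' * F'ᴴ = c • (1 : Matrix (Fin d) (Fin d) ℂ)) :
    (∃ A : U d, F' = A • F) ↔ F'ᴴ * F' = Fᴴ * F := by
  constructor
  · rintro ⟨A, rfl⟩
    rw [smul_eq_mul_matrix, Matrix.conjTranspose_mul, Matrix.mul_assoc, ← Matrix.mul_assoc _ _ F,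
      unitary_conjTranspose_mul, Matrix.one_mul]
  · intro h
    -- Equality of Gram matrices gives F'F*F = F'F'*F' = cF'.
    refine exists_unitary_of_left_mul hc hF hF' (k := c⁻¹ • (F' * Fᴴ)) ?_
    rw [Matrix.smul_mul, Matrix.mul_assoc, ← h, ← Matrix.mul_assoc, hF', Matrix.smul_mul,
      Matrix.one_mul, smul_smul, inv_mul_cancel₀ hc.ne', one_smul]

theorem contDiffAt_affineCoord (hF : (F * F₀ᴴ).det ≠ 0) :
    ContDiffAt ℝ ∞ (affineCoord c F₀) F :=
  (((contDiffAt_id.matrix_mul contDiffAt_const).matrix_inv hF).matrix_mul contDiffAt_id).sub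
    contDiffAt_const

theorem contDiff_scaledGram (c : ℝ) (F₀ : Matrix (Fin d) (Fin N) ℂ) :
    ContDiff ℝ ∞ (scaledGram c F₀) := by
  refine contDiff_iff_contDiffAt.2 fun Y => ?_
  have h : ContDiffAt ℝ ∞ (fun Y : Matrix (Fin d) (Fin N) ℂ => c⁻¹ • F₀ + Y) Y :=
    contDiffAt_const.add contDiffAt_id
  exact (h.matrix_mul h.matrix_conjTranspose).const_smul c

theorem contDiffAt_frameSection (hY : scaledGram c F₀ Y ∈ sqrtDom d) :
    ContDiffAt ℝ ∞ (frameSection c F₀) Y := by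
  have h : ContDiffAt ℝ ∞ (fun Y : Matrix (Fin d) (Fin N) ℂ => c⁻¹ • F₀ + Y) Y :=
    contDiffAt_const.add contDiffAt_id
  exact ((((invSqrt_spec d).2.2.2.1 _ hY).comp Y
    (contDiff_scaledGram c F₀).contDiffAt).matrix_mul h).const_smul c

theorem isOpen_coordDom (c : ℝ) (F₀ : Matrix (Fin d) (Fin N) ℂ) : IsOpen (coordDom c F₀) := by
  rw [isOpen_iff_mem_nhds]
  intro F hF
  have h1 : ∀ᶠ F' in 𝓝 F, (F' * F₀ᴴ).det ≠ 0 := eventually_det_ne_zero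
    (A := fun F' : Matrix (Fin d) (Fin N) ℂ => F' * F₀ᴴ)
    (continuous_id.matrix_mul continuous_const).continuousAt hF.1
  have h2 : ContinuousAt (fun F' => scaledGram c F₀ (affineCoord c F₀ F')) F :=
    (contDiff_scaledGram c F₀).continuous.continuousAt.comp
      (contDiffAt_affineCoord hF.1).continuousAt
  exact h1.and (h2.preimage_mem_nhds ((invSqrt_spec d).1.mem_nhds hF.2))

attribute [irreducible] sqrtDom invSqrt scaledGram frameSection affineCoord normalized

end LocalSections

/-! ### Euclidean parametrizations of subspaces. -/

section LinearParam

variable {E : Type*} [NormedAddCommGroup E] [NormedSpace ℝ E]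

/-- A linear parametrization of a subspace `H` of `E`, with a linear left inverse on `E`. -/
structure LinearParam (H : Submodule ℝ E) (W : Type*) [NormedAddCommGroup W]
    [NormedSpace ℝ W] where
  incl : W →L[ℝ] E
  proj : E →L[ℝ] W
  incl_mem : ∀ w, incl w ∈ H
  proj_incl : ∀ w, proj (incl w) = w
  incl_proj : ∀ y ∈ H, incl (proj y) = y

/-- A parametrization of a subspace by a Euclidean space of the same dimension. -/
noncomputable def LinearParam.ofFinrankEq [FiniteDimensional ℝ E] (H : Submodule ℝ E) {n : ℕ}
    (h : Module.finrank ℝ H = n) : LinearParam H (EuclideanSpace ℝ (Fin n)) :=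
  let e : H ≃L[ℝ] EuclideanSpace ℝ (Fin n) := ContinuousLinearEquiv.ofFinrankEq (by simp [h])
  -- A linear retraction of E onto H extends the coordinates on H to all of E, so that charts come
  -- from ambient maps.
  have hg := H.subtype.exists_leftInverse_of_injective H.ker_subtype
  have hg' : ∀ y : H, hg.choose y = y := fun y => DFunLike.congr_fun hg.choose_spec y
  { incl := H.subtypeL ∘L (e.symm : EuclideanSpace ℝ (Fin n) →L[ℝ] H)
    proj := (e : H →L[ℝ] EuclideanSpace ℝ (Fin n)) ∘L hg.choose.toContinuousLinearMap
    incl_mem := fun w => (e.symm w).2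
    proj_incl := fun w => by
      change e (hg.choose (e.symm w : E)) = w
      rw [hg', e.apply_symm_apply]
    incl_proj := fun y hy => by
      change ((e.symm (e (hg.choose y)) : H) : E) = y
      rw [e.symm_apply_apply]
      exact congrArg Subtype.val (hg' ⟨y, hy⟩) }

end LinearParam

/-! ### Topology of the orbit space. -/

section OrbitSpaceTopology

open Topology Filter Set

variable {d N : ℕ} {c : ℝ}

theorem orbitProj_eq_iff {S : Set (Matrix (Fin d) (Fin N) ℂ)} {p p' : S} :
    orbitProj (U d) S p = orbitProj (U d) S p' ↔
      ∃ A : U d, (p : Matrix (Fin d) (Fin N) ℂ) = A • (p' : Matrix (Fin d) (Fin N) ℂ) := by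
  rw [orbitProj, Quotient.eq]
  change (p : Matrix (Fin d) (Fin N) ℂ) ∈ MulAction.orbit (U d) (p' : Matrix (Fin d) (Fin N) ℂ) ↔ _
  simp only [MulAction.mem_orbit_iff, eq_comm]

/-- The saturation of an open set is the union of its preimages under the maps p ↦ A • p. -/
theorem isOpenQuotientMap_orbitProj (hc : 0 < c) :
    IsOpenQuotientMap (orbitProj (U d) (tightFrames d N c)) := by
  refine ⟨Quotient.mk_surjective, continuous_quotient_mk', fun O hO => ?_⟩
  rw [← isQuotientMap_quotient_mk'.isOpen_preimage]
  have h : (Quotient.mk _ : tightFrames d N c → OrbitSpace (U d) (tightFrames d N c)) ⁻¹'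
      (orbitProj (U d) (tightFrames d N c) '' O) =
      ⋃ A : U d, (fun p : tightFrames d N c =>
        (⟨A • (p : Matrix (Fin d) (Fin N) ℂ), smul_mem_tightFrames hc A p.2⟩ :
          tightFrames d N c)) ⁻¹' O := by
    ext p
    simp only [mem_preimage, mem_image, mem_iUnion]
    constructor
    · rintro ⟨p', hp', h⟩
      obtain ⟨A, hA⟩ := orbitProj_eq_iff.1 h
      exact ⟨A, by convert hp'; exact hA.symm⟩
    · rintro ⟨A, hA⟩
      exact ⟨_, hA, orbitProj_eq_iff.2 ⟨A, rfl⟩⟩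
  refine (congrArg IsOpen h).mpr ?_
  refine isOpen_iUnion fun A => hO.preimage ?_
  exact (continuous_const.matrix_mul continuous_subtype_val).subtype_mk _

/-- For an open quotient map it suffices that the orbit relation is closed, and here it is equality
of the continuous Gram matrices F*F. -/
theorem t2Space_orbitSpace (hc : 0 < c) : T2Space (OrbitSpace (U d) (tightFrames d N c)) := by
  rw [t2Space_iff_of_isOpenQuotientMap (isOpenQuotientMap_orbitProj hc)]
  have h : {x : tightFrames d N c × tightFrames d N c |
      orbitProj (U d) (tightFrames d N c) x.1 = orbitProj (U d) (tightFrames d N c) x.2} =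
      {x | (x.1 : Matrix (Fin d) (Fin N) ℂ)ᴴ * (x.1 : Matrix (Fin d) (Fin N) ℂ) =
        (x.2 : Matrix (Fin d) (Fin N) ℂ)ᴴ * (x.2 : Matrix (Fin d) (Fin N) ℂ)} := by
    ext x
    exact orbitProj_eq_iff.trans (exists_unitary_iff hc ((mem_tightFrames_iff hc).1 x.2.2)
      ((mem_tightFrames_iff hc).1 x.1.2))
  rw [h]
  have h1 : Continuous fun x : tightFrames d N c × tightFrames d N c =>
      (x.1 : Matrix (Fin d) (Fin N) ℂ) := continuous_subtype_val.comp continuous_fst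
  have h2 : Continuous fun x : tightFrames d N c × tightFrames d N c =>
      (x.2 : Matrix (Fin d) (Fin N) ℂ) := continuous_subtype_val.comp continuous_snd
  exact isClosed_eq (h1.matrix_conjTranspose.matrix_mul h1) (h2.matrix_conjTranspose.matrix_mul h2)

theorem secondCountableTopology_orbitSpace (hc : 0 < c) :
    SecondCountableTopology (OrbitSpace (U d) (tightFrames d N c)) := by
  have _ : SecondCountableTopology (Matrix (Fin d) (Fin N) ℂ) :=
    inferInstanceAs (SecondCountableTopology (Fin d → Fin N → ℂ))
  exact (isOpenQuotientMap_orbitProj hc).isQuotientMap.secondCountableTopology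
    (isOpenQuotientMap_orbitProj hc).isOpenMap

end OrbitSpaceTopology

/-! ### Charts of the orbit space. -/

section Charts

open Topology Filter Set

variable {d N : ℕ} {c : ℝ}

/-- The matrices whose rows are orthogonal to those of `F₀`. -/
noncomputable def horizontal (F₀ : Matrix (Fin d) (Fin N) ℂ) :
    Submodule ℝ (Matrix (Fin d) (Fin N) ℂ) where
  carrier := {Y | Y * F₀ᴴ = 0}
  add_mem' {X Y} hX hY := by
    change (X + Y) * F₀ᴴ = 0
    rw [Matrix.add_mul, show X * F₀ᴴ = 0 from hX, show Y * F₀ᴴ = 0 from hY, add_zero]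
  zero_mem' := Matrix.zero_mul _
  smul_mem' a X hX := by
    change (a • X) * F₀ᴴ = 0
    rw [Matrix.smul_mul, show X * F₀ᴴ = 0 from hX, smul_zero]

/-- Rank-nullity for Y ↦ YF₀*, which is onto because K F₀/c maps to K. -/
theorem finrank_horizontal (hc : 0 < c) {F₀ : Matrix (Fin d) (Fin N) ℂ}
    (hF₀ : F₀ * F₀ᴴ = c • (1 : Matrix (Fin d) (Fin d) ℂ)) :
    Module.finrank ℝ (horizontal F₀) = 2 * (d * N - d ^ 2) := by
  let L : Matrix (Fin d) (Fin N) ℂ →ₗ[ℝ] Matrix (Fin d) (Fin d) ℂ :=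
    { toFun := fun Y => Y * F₀ᴴ
      map_add' := fun X Y => Matrix.add_mul _ _ _
      map_smul' := fun a X => Matrix.smul_mul _ _ _ }
  have hk : LinearMap.ker L = horizontal F₀ := rfl
  have hr : LinearMap.range L = ⊤ := by
    refine LinearMap.range_eq_top.2 fun K => ⟨K * (c⁻¹ • F₀), ?_⟩
    change K * (c⁻¹ • F₀) * F₀ᴴ = K
    rw [Matrix.mul_assoc, base_mul hc hF₀, Matrix.mul_one]
  have h := L.finrank_range_add_finrank_ker
  rw [hr, finrank_top, finrank_matrix, finrank_matrix, hk] at h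
  have h2 : 2 * d * d = 2 * d ^ 2 := by ring
  have h3 : 2 * d * N = 2 * (d * N) := by ring
  omega

theorem unitary_det_ne_zero (A : U d) : (A : Matrix (Fin d) (Fin d) ℂ).det ≠ 0 := by
  intro h
  have := congrArg Matrix.det (unitary_mul_conjTranspose A)
  rw [Matrix.det_mul, h, zero_mul, Matrix.det_one] at this
  exact zero_ne_one this

open Classical in
/-- A matrix regarded as a point of `S`, with default value `p` if it is not in `S`. -/
noncomputable def toPoint {E : Type*} {S : Set E} (p : S) (y : E) : S :=
  if h : y ∈ S then ⟨y, h⟩ else p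

theorem toPoint_coe {E : Type*} {S : Set E} (p : S) {y : E} (hy : y ∈ S) :
    (toPoint p y : E) = y := by
  rw [toPoint, dif_pos hy]

variable {W V : Type*} [NormedAddCommGroup W] [NormedSpace ℝ W] [NormedAddCommGroup V]
  [NormedSpace ℝ V]

theorem frameSection_mem_tightFrames (hc : 0 < c) {F₀ Y : Matrix (Fin d) (Fin N) ℂ}
    (hY : scaledGram c F₀ Y ∈ sqrtDom d) : frameSection c F₀ Y ∈ tightFrames d N c :=
  (mem_tightFrames_iff hc).2 (frameSection_mul_conjTranspose hY)

/-- The local section of the orbit projection given by `frameSection`. -/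
noncomputable def orbitLift (p₀ : tightFrames d N c)
    (P : LinearParam (horizontal (p₀ : Matrix (Fin d) (Fin N) ℂ)) W) (w : W) :
    tightFrames d N c :=
  -- The default p₀ only occurs off the chart target; on the target the section is a tight frame.
  toPoint p₀ (frameSection c p₀ (P.incl w))

theorem orbitLift_coe (hc : 0 < c) (p₀ : tightFrames d N c)
    (P : LinearParam (horizontal (p₀ : Matrix (Fin d) (Fin N) ℂ)) W) {w : W}
    (hw : scaledGram c p₀ (P.incl w) ∈ sqrtDom d) :
    (orbitLift p₀ P w : Matrix (Fin d) (Fin N) ℂ) = frameSection c p₀ (P.incl w) :=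
  toPoint_coe p₀ (frameSection_mem_tightFrames hc hw)

theorem contDiff_scaledGram_incl (F₀ : Matrix (Fin d) (Fin N) ℂ)
    (L : W →L[ℝ] Matrix (Fin d) (Fin N) ℂ) : ContDiff ℝ ∞ (fun w => scaledGram c F₀ (L w)) :=
  (contDiff_scaledGram c F₀).comp L.contDiff

theorem isOpen_sectionDom (F₀ : Matrix (Fin d) (Fin N) ℂ)
    (L : W →L[ℝ] Matrix (Fin d) (Fin N) ℂ) :
    IsOpen {w | scaledGram c F₀ (L w) ∈ sqrtDom d} :=
  (invSqrt_spec d).1.preimage (contDiff_scaledGram_incl F₀ L).continuous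

theorem contDiffAt_frameSection_incl {F₀ : Matrix (Fin d) (Fin N) ℂ}
    {L : W →L[ℝ] Matrix (Fin d) (Fin N) ℂ} {w : W} (hw : scaledGram c F₀ (L w) ∈ sqrtDom d) :
    ContDiffAt ℝ ∞ (fun w => frameSection c F₀ (L w)) w :=
  (contDiffAt_frameSection hw).comp w L.contDiff.contDiffAt

theorem contDiffAt_proj_affineCoord {F₀ F : Matrix (Fin d) (Fin N) ℂ}
    (L : Matrix (Fin d) (Fin N) ℂ →L[ℝ] W) (hF : F ∈ coordDom c F₀) :
    ContDiffAt ℝ ∞ (fun F => L (affineCoord c F₀ F)) F :=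
  L.contDiff.contDiffAt.comp F (contDiffAt_affineCoord hF.1)

theorem isOpen_orbitProj_coordDom (hc : 0 < c) (F₀ : Matrix (Fin d) (Fin N) ℂ) :
    IsOpen {x | ∃ p : tightFrames d N c, (p : Matrix (Fin d) (Fin N) ℂ) ∈ coordDom c F₀ ∧
      orbitProj (U d) _ p = x} :=
  (isOpenQuotientMap_orbitProj hc).isOpenMap _
    ((isOpen_coordDom c F₀).preimage continuous_subtype_val)

theorem continuousOn_orbitLift (hc : 0 < c) (p₀ : tightFrames d N c)
    (P : LinearParam (horizontal (p₀ : Matrix (Fin d) (Fin N) ℂ)) W) :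
    ContinuousOn (orbitLift p₀ P) {w | scaledGram c p₀ (P.incl w) ∈ sqrtDom d} := by
  rw [Topology.IsInducing.subtypeVal.continuousOn_iff]
  refine ContinuousOn.congr
    (f := fun w => frameSection c (p₀ : Matrix (Fin d) (Fin N) ℂ) (P.incl w)) ?_
    fun w hw => orbitLift_coe hc p₀ P hw
  intro w hw
  exact (contDiffAt_frameSection_incl hw).continuousAt.continuousWithinAt

theorem coordDom_of_orbitProj_eq {F₀ : Matrix (Fin d) (Fin N) ℂ} {p p' : tightFrames d N c}
    (hp' : (p' : Matrix (Fin d) (Fin N) ℂ) ∈ coordDom c F₀)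
    (h : orbitProj (U d) _ p' = orbitProj (U d) _ p) :
    (p : Matrix (Fin d) (Fin N) ℂ) ∈ coordDom c F₀ := by
  obtain ⟨A, hA⟩ := orbitProj_eq_iff.1 h.symm
  rw [hA]
  exact left_mul_mem_coordDom (unitary_det_ne_zero A) hp'

/-- The chart of the orbit space around the orbit of `p₀`. -/
noncomputable def orbitChart (hc : 0 < c) (p₀ : tightFrames d N c)
    (P : LinearParam (horizontal (p₀ : Matrix (Fin d) (Fin N) ℂ)) W) :
    OpenPartialHomeomorph (OrbitSpace (U d) (tightFrames d N c)) W where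
  toFun := Quotient.lift
    (fun p : tightFrames d N c => P.proj (affineCoord c p₀ (p : Matrix (Fin d) (Fin N) ℂ))) (by
      intro p p' h
      obtain ⟨A, hA⟩ := orbitProj_eq_iff.1 (Quotient.sound h)
      simp only [hA, smul_eq_mul_matrix, affineCoord_left_mul (unitary_det_ne_zero A)])
  invFun w := orbitProj (U d) _ (orbitLift p₀ P w)
  source := {x | ∃ p : tightFrames d N c, (p : Matrix (Fin d) (Fin N) ℂ) ∈ coordDom c p₀ ∧
    orbitProj (U d) _ p = x}
  target := {w | scaledGram c p₀ (P.incl w) ∈ sqrtDom d}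
  map_source' := by
    rintro _ ⟨p, hp, rfl⟩
    change scaledGram c p₀ (P.incl (P.proj (affineCoord c p₀ p))) ∈ sqrtDom d
    rw [P.incl_proj _ (affineCoord_mul hc ((mem_tightFrames_iff hc).1 p₀.2) hp.1)]
    exact hp.2
  map_target' w hw := by
    refine ⟨_, ?_, rfl⟩
    rw [orbitLift_coe hc p₀ P hw]
    exact frameSection_mem_coordDom hc ((mem_tightFrames_iff hc).1 p₀.2) (P.incl_mem w) hw
  left_inv' := by
    rintro _ ⟨p, hp, rfl⟩
    change orbitProj (U d) _ (orbitLift p₀ P (P.proj (affineCoord c p₀ p))) = _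
    have h := P.incl_proj _ (affineCoord_mul hc ((mem_tightFrames_iff hc).1 p₀.2) hp.1)
    rw [orbitProj_eq_iff, orbitLift_coe hc p₀ P (by rw [h]; exact hp.2), h]
    -- The section returns p only up to a unitary factor, which is enough in the quotient.
    exact exists_unitary_frameSection hc ((mem_tightFrames_iff hc).1 p.2) hp
  right_inv' w hw := by
    change P.proj (affineCoord c p₀ (orbitLift p₀ P w : Matrix (Fin d) (Fin N) ℂ)) = w
    rw [orbitLift_coe hc p₀ P hw, affineCoord_frameSection hc ((mem_tightFrames_iff hc).1 p₀.2)
      (P.incl_mem w) hw, P.proj_incl]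
  open_source := isOpen_orbitProj_coordDom hc _
  open_target := isOpen_sectionDom _ P.incl
  continuousOn_toFun := by
    refine ((isOpenQuotientMap_orbitProj hc).isQuotientMap.continuousOn_isOpen_iff
      (isOpen_orbitProj_coordDom hc _)).2 ?_
    rintro p ⟨p', hp', h⟩
    have h1 := (contDiffAt_proj_affineCoord P.proj (coordDom_of_orbitProj_eq hp' h)).continuousAt
    exact (ContinuousAt.comp (x := p) h1 continuous_subtype_val.continuousAt).continuousWithinAt
  continuousOn_invFun := (isOpenQuotientMap_orbitProj hc).continuous.comp_continuousOn
    (continuousOn_orbitLift hc p₀ P)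

theorem proj_mem_orbitChart_source (hc : 0 < c) (p₀ : tightFrames d N c)
    (P : LinearParam (horizontal (p₀ : Matrix (Fin d) (Fin N) ℂ)) W) (p : tightFrames d N c) :
    orbitProj (U d) _ p ∈ (orbitChart hc p₀ P).source ↔
      (p : Matrix (Fin d) (Fin N) ℂ) ∈ coordDom c p₀ := by
  constructor
  · rintro ⟨p', hp', h⟩
    exact coordDom_of_orbitProj_eq hp' h
  · intro h
    exact ⟨p, h, rfl⟩

/-- A parametrization of the horizontal space at a tight frame. -/
noncomputable def horizontalParam (hc : 0 < c) (p₀ : tightFrames d N c) :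
    LinearParam (horizontal (p₀ : Matrix (Fin d) (Fin N) ℂ))
      (EuclideanSpace ℝ (Fin (2 * (d * N - d ^ 2)))) :=
  LinearParam.ofFinrankEq _ (finrank_horizontal hc ((mem_tightFrames_iff hc).1 p₀.2))

/-- The slice atlas of the orbit space of tight frames. -/
noncomputable def orbitAtlas (d N : ℕ) (hc : 0 < c) :
    SliceAtlas (tightFrames d N c) (orbitProj (U d) (tightFrames d N c))
      (EuclideanSpace ℝ (Fin (2 * (d * N - d ^ 2)))) where
  chart x := orbitChart hc x.out (horizontalParam hc x.out)
  mem_source x := ⟨x.out, self_mem_coordDom hc ((mem_tightFrames_iff hc).1 x.out.2), x.out_eq⟩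
  lift x := orbitLift x.out (horizontalParam hc x.out)
  proj_lift _ _ _ := rfl
  contDiffOn_lift x := by
    refine ContDiffOn.congr
      (f := fun w => frameSection c (x.out : Matrix (Fin d) (Fin N) ℂ)
        ((horizontalParam hc x.out).incl w)) ?_
      fun w hw => orbitLift_coe hc x.out (horizontalParam hc x.out) hw
    intro w hw
    exact (contDiffAt_frameSection_incl hw).contDiffWithinAt
  coord x F := (horizontalParam hc x.out).proj (affineCoord c x.out F)
  dom x := coordDom c x.out
  isOpen_dom x := isOpen_coordDom c _
  contDiffOn_coord x F hF := (contDiffAt_proj_affineCoord _ hF).contDiffWithinAt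
  mem_dom x p hp := (proj_mem_orbitChart_source hc _ _ p).1 hp
  coord_eq _ _ _ := rfl

end Charts

/-! ### Charts of the space of tight frames. -/

section LevelCharts

open Topology Filter Set

variable {d N : ℕ} {c : ℝ}

/-- The matrix carrying the standard representative of the orbit of `F` to `F`. -/
noncomputable def frameUnitary (c : ℝ) (F₀ F : Matrix (Fin d) (Fin N) ℂ) :
    Matrix (Fin d) (Fin d) ℂ :=
  c⁻¹ • (F * (frameSection c F₀ (affineCoord c F₀ F))ᴴ)

variable {F₀ F Y : Matrix (Fin d) (Fin N) ℂ}

theorem frameUnitary_eq (hc : 0 < c) (hF : F * Fᴴ = c • (1 : Matrix (Fin d) (Fin d) ℂ))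
    {A : U d} (hA : frameSection c F₀ (affineCoord c F₀ F) = A • F) :
    frameUnitary c F₀ F = (A : Matrix (Fin d) (Fin d) ℂ)ᴴ := by
  rw [frameUnitary, hA, smul_eq_mul_matrix, Matrix.conjTranspose_mul, ← Matrix.mul_assoc, hF,
    Matrix.smul_mul, Matrix.one_mul, smul_smul, inv_mul_cancel₀ hc.ne', one_smul]

theorem frameUnitary_mul_conjTranspose (hc : 0 < c)
    (hF : F * Fᴴ = c • (1 : Matrix (Fin d) (Fin d) ℂ)) (hd : F ∈ coordDom c F₀) :
    frameUnitary c F₀ F * (frameUnitary c F₀ F)ᴴ = 1 := by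
  obtain ⟨A, hA⟩ := exists_unitary_frameSection hc hF hd
  rw [frameUnitary_eq hc hF hA, Matrix.conjTranspose_conjTranspose, unitary_conjTranspose_mul]

theorem frameUnitary_mul_frameSection (hc : 0 < c)
    (hF : F * Fᴴ = c • (1 : Matrix (Fin d) (Fin d) ℂ)) (hd : F ∈ coordDom c F₀) :
    frameUnitary c F₀ F * frameSection c F₀ (affineCoord c F₀ F) = F := by
  obtain ⟨A, hA⟩ := exists_unitary_frameSection hc hF hd
  rw [frameUnitary_eq hc hF hA, hA, smul_eq_mul_matrix, ← Matrix.mul_assoc,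
    unitary_conjTranspose_mul, Matrix.one_mul]

theorem det_ne_zero_of_mul_conjTranspose {a : Matrix (Fin d) (Fin d) ℂ} (ha : a * aᴴ = 1) :
    a.det ≠ 0 :=
  unitary_det_ne_zero ⟨a, Matrix.mem_unitaryGroup_iff.2 ha⟩

theorem affineCoord_unitary_mul_frameSection (hc : 0 < c)
    (hF₀ : F₀ * F₀ᴴ = c • (1 : Matrix (Fin d) (Fin d) ℂ)) (hY0 : Y * F₀ᴴ = 0)
    (hY : scaledGram c F₀ Y ∈ sqrtDom d) {a : Matrix (Fin d) (Fin d) ℂ} (ha : a * aᴴ = 1) :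
    affineCoord c F₀ (a * frameSection c F₀ Y) = Y := by
  rw [affineCoord_left_mul (det_ne_zero_of_mul_conjTranspose ha),
    affineCoord_frameSection hc hF₀ hY0 hY]

theorem frameUnitary_unitary_mul_frameSection (hc : 0 < c)
    (hF₀ : F₀ * F₀ᴴ = c • (1 : Matrix (Fin d) (Fin d) ℂ)) (hY0 : Y * F₀ᴴ = 0)
    (hY : scaledGram c F₀ Y ∈ sqrtDom d) {a : Matrix (Fin d) (Fin d) ℂ} (ha : a * aᴴ = 1) :
    frameUnitary c F₀ (a * frameSection c F₀ Y) = a := by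
  rw [frameUnitary, affineCoord_unitary_mul_frameSection hc hF₀ hY0 hY ha, Matrix.mul_assoc,
    frameSection_mul_conjTranspose hY, Matrix.mul_smul, Matrix.mul_one, smul_smul,
    inv_mul_cancel₀ hc.ne', one_smul]

theorem unitary_mul_frameSection_mem (hc : 0 < c) (hY : scaledGram c F₀ Y ∈ sqrtDom d)
    {a : Matrix (Fin d) (Fin d) ℂ} (ha : a * aᴴ = 1) :
    a * frameSection c F₀ Y ∈ tightFrames d N c :=
  smul_mem_tightFrames hc ⟨a, Matrix.mem_unitaryGroup_iff.2 ha⟩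
    (frameSection_mem_tightFrames hc hY)

theorem frameUnitary_self (hc : 0 < c)
    (hF₀ : F₀ * F₀ᴴ = c • (1 : Matrix (Fin d) (Fin d) ℂ)) : frameUnitary c F₀ F₀ = 1 := by
  rw [frameUnitary, affineCoord_self hc hF₀, frameSection_zero hc hF₀, hF₀, smul_smul,
    inv_mul_cancel₀ hc.ne', one_smul]

theorem contDiffAt_frameUnitary (hF : F ∈ coordDom c F₀) :
    ContDiffAt ℝ ∞ (frameUnitary c F₀) F := by
  have h : ContDiffAt ℝ ∞ (fun F => frameSection c F₀ (affineCoord c F₀ F)) F :=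
    (contDiffAt_frameSection hF.2).comp F (contDiffAt_affineCoord hF.1)
  exact (contDiffAt_id.matrix_mul h.matrix_conjTranspose).const_smul c⁻¹

/-- The domain of the chart of the space of tight frames around `F₀`. -/
def levelDom (c : ℝ) (F₀ : Matrix (Fin d) (Fin N) ℂ) : Set (Matrix (Fin d) (Fin N) ℂ) :=
  {F | F ∈ coordDom c F₀ ∧ (1 + frameUnitary c F₀ F).det ≠ 0}

theorem isOpen_levelDom (c : ℝ) (F₀ : Matrix (Fin d) (Fin N) ℂ) : IsOpen (levelDom c F₀) := by
  rw [isOpen_iff_mem_nhds]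
  intro F hF
  have h1 : ContinuousAt (fun F => 1 + frameUnitary c F₀ F) F :=
    continuousAt_const.add (contDiffAt_frameUnitary hF.1).continuousAt
  exact inter_mem ((isOpen_coordDom c F₀).mem_nhds hF.1) (eventually_det_ne_zero h1 hF.2)

theorem self_mem_levelDom (hc : 0 < c)
    (hF₀ : F₀ * F₀ᴴ = c • (1 : Matrix (Fin d) (Fin d) ℂ)) : F₀ ∈ levelDom c F₀ := by
  refine ⟨self_mem_coordDom hc hF₀, ?_⟩
  -- At the centre the unitary factor is 1, so 1 + 1 is invertible and the Cayley transform is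
  -- defined there.
  rw [frameUnitary_self hc hF₀, ← two_smul ℝ (1 : Matrix (Fin d) (Fin d) ℂ)]
  exact det_smul_one_ne_zero two_pos

/-- Pairs of a skew-Hermitian matrix and a horizontal matrix. -/
noncomputable def levelModel (F₀ : Matrix (Fin d) (Fin N) ℂ) :
    Submodule ℝ (Matrix (Fin d) (Fin d) ℂ × Matrix (Fin d) (Fin N) ℂ) :=
  (LieU d).prod (horizontal F₀)

theorem finrank_levelModel (hc : 0 < c) (hdN : d ≤ N)
    (hF₀ : F₀ * F₀ᴴ = c • (1 : Matrix (Fin d) (Fin d) ℂ)) :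
    Module.finrank ℝ (levelModel F₀) = 2 * d * N - d ^ 2 := by
  have h : Module.finrank ℝ (levelModel F₀) =
      Module.finrank ℝ (LieU d × horizontal F₀) :=
    LinearEquiv.finrank_eq
      { toFun := fun x => (⟨x.1.1, x.2.1⟩, ⟨x.1.2, x.2.2⟩)
        invFun := fun y => ⟨(y.1, y.2), y.1.2, y.2.2⟩
        map_add' := fun _ _ => rfl
        map_smul' := fun _ _ => rfl
        left_inv := fun _ => rfl
        right_inv := fun _ => rfl }
  rw [h, Module.finrank_prod, finrank_lieU, finrank_horizontal hc hF₀]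
  -- Needed so that d² + 2(dN - d²) = 2dN - d² holds with truncated subtraction.
  have h2 : d ^ 2 ≤ d * N := by rw [pow_two]; exact Nat.mul_le_mul_left d hdN
  have h3 : 2 * d * N = 2 * (d * N) := by ring
  omega

variable {V : Type*} [NormedAddCommGroup V] [NormedSpace ℝ V]

/-- The tight frame with given coordinates. -/
noncomputable def levelPoint (c : ℝ) (F₀ : Matrix (Fin d) (Fin N) ℂ)
    (x : Matrix (Fin d) (Fin d) ℂ × Matrix (Fin d) (Fin N) ℂ) : Matrix (Fin d) (Fin N) ℂ :=
  cayley x.1 * frameSection c F₀ x.2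

/-- The coordinates of a tight frame. -/
noncomputable def levelCoord (c : ℝ) (F₀ F : Matrix (Fin d) (Fin N) ℂ) :
    Matrix (Fin d) (Fin d) ℂ × Matrix (Fin d) (Fin N) ℂ :=
  (cayley (frameUnitary c F₀ F), affineCoord c F₀ F)

/-- The domain of `levelPoint`. -/
def levelTarget (c : ℝ) (F₀ : Matrix (Fin d) (Fin N) ℂ) :
    Set (Matrix (Fin d) (Fin d) ℂ × Matrix (Fin d) (Fin N) ℂ) :=
  {x | scaledGram c F₀ x.2 ∈ sqrtDom d ∧ (1 + x.1).det ≠ 0}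

theorem isOpen_levelTarget (c : ℝ) (F₀ : Matrix (Fin d) (Fin N) ℂ) :
    IsOpen (levelTarget c F₀) := by
  have h1 : Continuous fun x : Matrix (Fin d) (Fin d) ℂ × Matrix (Fin d) (Fin N) ℂ =>
      (1 + x.1).det := (continuous_const.add continuous_fst).matrix_det
  have h2 : Continuous fun x : Matrix (Fin d) (Fin d) ℂ × Matrix (Fin d) (Fin N) ℂ =>
      scaledGram c F₀ x.2 := (contDiff_scaledGram c F₀).continuous.comp continuous_snd
  exact ((invSqrt_spec d).1.preimage h2).inter (isOpen_ne_fun h1 continuous_const)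

theorem contDiffAt_levelPoint {x : Matrix (Fin d) (Fin d) ℂ × Matrix (Fin d) (Fin N) ℂ}
    (hx : x ∈ levelTarget c F₀) : ContDiffAt ℝ ∞ (levelPoint c F₀) x := by
  have h2 : ContDiffAt ℝ ∞ (fun x : Matrix (Fin d) (Fin d) ℂ × Matrix (Fin d) (Fin N) ℂ =>
      frameSection c F₀ x.2) x := (contDiffAt_frameSection hx.1).comp x contDiffAt_snd
  have h1 : ContDiffAt ℝ ∞ (fun x : Matrix (Fin d) (Fin d) ℂ × Matrix (Fin d) (Fin N) ℂ =>
      cayley x.1) x := ContDiffAt.cayley contDiffAt_fst hx.2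
  exact h1.matrix_mul h2

theorem contDiffAt_levelCoord (hF : F ∈ levelDom c F₀) :
    ContDiffAt ℝ ∞ (levelCoord c F₀) F :=
  (ContDiffAt.cayley (contDiffAt_frameUnitary hF.1) hF.2).prodMk
    (contDiffAt_affineCoord hF.1.1)

theorem levelPoint_mem (hc : 0 < c) {x : Matrix (Fin d) (Fin d) ℂ × Matrix (Fin d) (Fin N) ℂ}
    (hx : x ∈ levelTarget c F₀) (hm : x ∈ levelModel F₀) :
    levelPoint c F₀ x ∈ tightFrames d N c :=
  unitary_mul_frameSection_mem hc hx.1 (cayley_mul_conjTranspose hm.1 hx.2)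

/-- The unitary factor does not change the row space, so Y is recovered first. Multiplying by the
adjoint of the section and dividing by c then recovers the factor. -/
theorem levelCoord_levelPoint (hc : 0 < c)
    (hF₀ : F₀ * F₀ᴴ = c • (1 : Matrix (Fin d) (Fin d) ℂ))
    {x : Matrix (Fin d) (Fin d) ℂ × Matrix (Fin d) (Fin N) ℂ}
    (hx : x ∈ levelTarget c F₀) (hm : x ∈ levelModel F₀) :
    levelCoord c F₀ (levelPoint c F₀ x) = x := by
  have ha := cayley_mul_conjTranspose hm.1 hx.2
  rw [levelCoord, levelPoint, frameUnitary_unitary_mul_frameSection hc hF₀ hm.2 hx.1 ha,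
    affineCoord_unitary_mul_frameSection hc hF₀ hm.2 hx.1 ha, cayley_cayley hx.2]

theorem levelPoint_mem_levelDom (hc : 0 < c)
    (hF₀ : F₀ * F₀ᴴ = c • (1 : Matrix (Fin d) (Fin d) ℂ))
    {x : Matrix (Fin d) (Fin d) ℂ × Matrix (Fin d) (Fin N) ℂ}
    (hx : x ∈ levelTarget c F₀) (hm : x ∈ levelModel F₀) :
    levelPoint c F₀ x ∈ levelDom c F₀ := by
  have ha := cayley_mul_conjTranspose hm.1 hx.2
  refine ⟨left_mul_mem_coordDom (det_ne_zero_of_mul_conjTranspose ha)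
    (frameSection_mem_coordDom hc hF₀ hm.2 hx.1), ?_⟩
  rw [levelPoint, frameUnitary_unitary_mul_frameSection hc hF₀ hm.2 hx.1 ha]
  exact det_one_add_cayley hx.2

theorem levelCoord_mem_levelModel (hc : 0 < c)
    (hF₀ : F₀ * F₀ᴴ = c • (1 : Matrix (Fin d) (Fin d) ℂ))
    (hF : F * Fᴴ = c • (1 : Matrix (Fin d) (Fin d) ℂ)) (hFd : F ∈ levelDom c F₀) :
    levelCoord c F₀ F ∈ levelModel F₀ :=
  ⟨conjTranspose_cayley (frameUnitary_mul_conjTranspose hc hF hFd.1) hFd.2,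
    affineCoord_mul hc hF₀ hFd.1.1⟩

theorem levelCoord_mem_levelTarget (hFd : F ∈ levelDom c F₀) :
    levelCoord c F₀ F ∈ levelTarget c F₀ :=
  ⟨hFd.1.2, det_one_add_cayley hFd.2⟩

theorem levelPoint_levelCoord (hc : 0 < c)
    (hF : F * Fᴴ = c • (1 : Matrix (Fin d) (Fin d) ℂ)) (hFd : F ∈ levelDom c F₀) :
    levelPoint c F₀ (levelCoord c F₀ F) = F := by
  rw [levelPoint, levelCoord]
  simp only
  rw [cayley_cayley hFd.2, frameUnitary_mul_frameSection hc hF hFd.1]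

attribute [irreducible] levelPoint levelCoord levelTarget levelDom levelModel frameUnitary

theorem contDiffAt_levelPoint_incl {L : V →L[ℝ] Matrix (Fin d) (Fin d) ℂ × Matrix (Fin d) (Fin N) ℂ}
    {v : V} (hv : L v ∈ levelTarget c F₀) : ContDiffAt ℝ ∞ (fun v => levelPoint c F₀ (L v)) v :=
  (contDiffAt_levelPoint hv).comp v L.contDiff.contDiffAt

theorem contDiffAt_proj_levelCoord
    (L : Matrix (Fin d) (Fin d) ℂ × Matrix (Fin d) (Fin N) ℂ →L[ℝ] V)
    (hF : F ∈ levelDom c F₀) : ContDiffAt ℝ ∞ (fun F => L (levelCoord c F₀ F)) F :=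
  L.contDiff.contDiffAt.comp F (contDiffAt_levelCoord hF)

/-- The inverse of the chart of the space of tight frames around `p₀`. -/
noncomputable def levelLift (p₀ : tightFrames d N c)
    (P : LinearParam (levelModel (p₀ : Matrix (Fin d) (Fin N) ℂ)) V) (v : V) :
    tightFrames d N c :=
  toPoint p₀ (levelPoint c p₀ (P.incl v))

theorem levelLift_coe (hc : 0 < c) (p₀ : tightFrames d N c)
    (P : LinearParam (levelModel (p₀ : Matrix (Fin d) (Fin N) ℂ)) V) {v : V}
    (hv : P.incl v ∈ levelTarget c (p₀ : Matrix (Fin d) (Fin N) ℂ)) :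
    (levelLift p₀ P v : Matrix (Fin d) (Fin N) ℂ) = levelPoint c p₀ (P.incl v) :=
  toPoint_coe p₀ (levelPoint_mem hc hv (P.incl_mem v))

/-- The chart of the space of tight frames around `p₀`. -/
noncomputable def levelChart (hc : 0 < c) (p₀ : tightFrames d N c)
    (P : LinearParam (levelModel (p₀ : Matrix (Fin d) (Fin N) ℂ)) V) :
    OpenPartialHomeomorph (tightFrames d N c) V where
  toFun p := P.proj (levelCoord c p₀ (p : Matrix (Fin d) (Fin N) ℂ))
  invFun := levelLift p₀ P
  source := Subtype.val ⁻¹' levelDom c (p₀ : Matrix (Fin d) (Fin N) ℂ)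
  target := P.incl ⁻¹' levelTarget c (p₀ : Matrix (Fin d) (Fin N) ℂ)
  map_source' p hp := by
    rw [mem_preimage, P.incl_proj _ (levelCoord_mem_levelModel hc
      ((mem_tightFrames_iff hc).1 p₀.2) ((mem_tightFrames_iff hc).1 p.2) hp)]
    exact levelCoord_mem_levelTarget hp
  map_target' v hv := by
    rw [mem_preimage, levelLift_coe hc p₀ P hv]
    exact levelPoint_mem_levelDom hc ((mem_tightFrames_iff hc).1 p₀.2) hv (P.incl_mem v)
  left_inv' p hp := by
    have h := P.incl_proj _ (levelCoord_mem_levelModel hc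
      ((mem_tightFrames_iff hc).1 p₀.2) ((mem_tightFrames_iff hc).1 p.2) hp)
    ext1
    rw [levelLift_coe hc p₀ P (by rw [h]; exact levelCoord_mem_levelTarget hp), h]
    exact levelPoint_levelCoord hc ((mem_tightFrames_iff hc).1 p.2) hp
  right_inv' v hv := by
    rw [levelLift_coe hc p₀ P hv, levelCoord_levelPoint hc ((mem_tightFrames_iff hc).1 p₀.2) hv
      (P.incl_mem v), P.proj_incl]
  open_source := (isOpen_levelDom c _).preimage continuous_subtype_val
  open_target := (isOpen_levelTarget c _).preimage P.incl.continuous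
  continuousOn_toFun p hp :=
    (ContinuousAt.comp (x := p) (contDiffAt_proj_levelCoord P.proj hp).continuousAt
      continuous_subtype_val.continuousAt).continuousWithinAt
  continuousOn_invFun := by
    rw [Topology.IsInducing.subtypeVal.continuousOn_iff]
    refine ContinuousOn.congr
      (f := fun v => levelPoint c (p₀ : Matrix (Fin d) (Fin N) ℂ) (P.incl v)) ?_
      fun v hv => levelLift_coe hc p₀ P hv
    intro v hv
    exact (contDiffAt_levelPoint_incl hv).continuousAt.continuousWithinAt

/-- A parametrization of the model space of the chart at a tight frame. -/
noncomputable def levelParam (hc : 0 < c) (hdN : d ≤ N) (p₀ : tightFrames d N c) :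
    LinearParam (levelModel (p₀ : Matrix (Fin d) (Fin N) ℂ))
      (EuclideanSpace ℝ (Fin (2 * d * N - d ^ 2))) :=
  LinearParam.ofFinrankEq _ (finrank_levelModel hc hdN ((mem_tightFrames_iff hc).1 p₀.2))

/-- The slice atlas of the space of tight frames. -/
noncomputable def levelAtlas (hc : 0 < c) (hdN : d ≤ N) :
    SliceAtlas (tightFrames d N c) (id : tightFrames d N c → tightFrames d N c)
      (EuclideanSpace ℝ (Fin (2 * d * N - d ^ 2))) where
  chart p := levelChart hc p (levelParam hc hdN p)
  mem_source p := self_mem_levelDom hc ((mem_tightFrames_iff hc).1 p.2)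
  lift p := levelLift p (levelParam hc hdN p)
  proj_lift _ _ _ := rfl
  contDiffOn_lift p := by
    refine ContDiffOn.congr
      (f := fun v => levelPoint c (p : Matrix (Fin d) (Fin N) ℂ) ((levelParam hc hdN p).incl v))
      ?_ fun v hv => levelLift_coe hc p (levelParam hc hdN p) hv
    intro v hv
    exact (contDiffAt_levelPoint_incl hv).contDiffWithinAt
  coord p F := (levelParam hc hdN p).proj (levelCoord c p F)
  dom p := levelDom c p
  isOpen_dom p := isOpen_levelDom c _
  contDiffOn_coord p F hF := (contDiffAt_proj_levelCoord _ hF).contDiffWithinAt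
  mem_dom _ _ hp := hp
  coord_eq _ _ _ := rfl

end LevelCharts

/-! ### Tangent spaces, orbit directions, and the reduced form. -/

section Reduction

open Topology Filter Set

variable {d N : ℕ} {c : ℝ}

theorem stdAlt_swap (X Y : Matrix (Fin d) (Fin N) ℂ) :
    stdAlt d N ![X, Y] = -stdAlt d N ![Y, X] := by
  rw [stdAlt_apply, stdAlt_apply]
  have := congrArg Complex.im (Matrix.trace_conjTranspose (Yᴴ * X))
  rw [Matrix.conjTranspose_mul, Matrix.conjTranspose_conjTranspose, Complex.star_def,
    Complex.conj_im] at this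
  rw [this, neg_neg]

theorem stdAlt_add_left (X X' Y : Matrix (Fin d) (Fin N) ℂ) :
    stdAlt d N ![X + X', Y] = stdAlt d N ![X, Y] + stdAlt d N ![X', Y] := by
  rw [stdAlt_apply, stdAlt_apply, stdAlt_apply, Matrix.mul_add, Matrix.trace_add, Complex.add_im]
  ring

theorem stdAlt_add_right (X Y Y' : Matrix (Fin d) (Fin N) ℂ) :
    stdAlt d N ![X, Y + Y'] = stdAlt d N ![X, Y] + stdAlt d N ![X, Y'] := by
  rw [stdAlt_swap, stdAlt_add_left, stdAlt_swap X Y, stdAlt_swap X Y']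
  ring

theorem gramDeriv_lie_mul {F : Matrix (Fin d) (Fin N) ℂ}
    (hF : F * Fᴴ = c • (1 : Matrix (Fin d) (Fin d) ℂ)) (ξ : LieU d) :
    gramDeriv F ((ξ : Matrix (Fin d) (Fin d) ℂ) * F) = 0 := by
  rw [gramDeriv_apply, Matrix.conjTranspose_mul, ← Matrix.mul_assoc, hF, Matrix.mul_assoc, hF,
    lieU_coe, Matrix.smul_mul, Matrix.mul_smul, Matrix.one_mul, Matrix.mul_one, smul_neg,
    neg_add_cancel, neg_zero]

/-- By the momentum identity, orbit directions are ω-orthogonal to ker dΦ. -/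
theorem stdAlt_lie_mul_eq_zero {F Y : Matrix (Fin d) (Fin N) ℂ} (ξ : LieU d)
    (hY : gramDeriv F Y = 0) : stdAlt d N ![(ξ : Matrix (Fin d) (Fin d) ℂ) * F, Y] = 0 := by
  rw [stdAlt_lie_mul, hY]
  exact (pairingL ξ).map_zero

/-- Infinitesimal motions along the group orbits do not change the form on a level set. -/
theorem stdAlt_add_lie_mul {F X Y : Matrix (Fin d) (Fin N) ℂ}
    (hF : F * Fᴴ = c • (1 : Matrix (Fin d) (Fin d) ℂ)) (ξ η : LieU d)
    (hX : gramDeriv F X = 0) (hY : gramDeriv F Y = 0) :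
    stdAlt d N ![X + (ξ : Matrix (Fin d) (Fin d) ℂ) * F,
      Y + (η : Matrix (Fin d) (Fin d) ℂ) * F] = stdAlt d N ![X, Y] := by
  rw [stdAlt_add_left, stdAlt_add_right, stdAlt_add_right, stdAlt_lie_mul_eq_zero ξ hY,
    stdAlt_lie_mul_eq_zero ξ (gramDeriv_lie_mul hF η),
    stdAlt_swap X ((η : Matrix (Fin d) (Fin d) ℂ) * F),
    stdAlt_lie_mul_eq_zero η hX]
  ring

variable {V : Type*} [NormedAddCommGroup V] [NormedSpace ℝ V]

theorem gramDeriv_tangent {γ : V → Matrix (Fin d) (Fin N) ℂ}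
    {γ' : V →L[ℝ] Matrix (Fin d) (Fin N) ℂ} {v₀ : V} (hγ : HasFDerivAt γ γ' v₀)
    (hS : ∀ᶠ v in 𝓝 v₀, γ v * (γ v)ᴴ = c • (1 : Matrix (Fin d) (Fin d) ℂ)) (v : V) :
    gramDeriv (γ v₀) (γ' v) = 0 := by
  have h1 := (hasFDerivAt_gram (γ v₀)).comp v₀ hγ
  have h2 : HasFDerivAt (fun _ : V => -(c • (1 : Matrix (Fin d) (Fin d) ℂ)))
      (0 : V →L[ℝ] Matrix (Fin d) (Fin d) ℂ) v₀ := hasFDerivAt_const _ _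
  have h3 := h1.unique (h2.congr_of_eventuallyEq (hS.mono fun v hv => congrArg Neg.neg hv))
  exact DFunLike.congr_fun h3 v

/-- Two families of tight frames that differ by unitary matrices pull back the standard form to
the same form. -/
theorem stdAlt_deriv_eq (hc : 0 < c) {γ η : V → Matrix (Fin d) (Fin N) ℂ}
    {γ' η' : V →L[ℝ] Matrix (Fin d) (Fin N) ℂ} {v₀ : V} (hγ : HasFDerivAt γ γ' v₀)
    (hη : HasFDerivAt η η' v₀)
    (hS : ∀ᶠ v in 𝓝 v₀, γ v * (γ v)ᴴ = c • (1 : Matrix (Fin d) (Fin d) ℂ))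
    (hU : ∀ᶠ v in 𝓝 v₀, ∃ A : U d, η v = A • γ v) (v w : V) :
    stdAlt d N ![η' v, η' w] = stdAlt d N ![γ' v, γ' w] := by
  -- The unitaries are only given pointwise; this formula recovers them from the two families, so
  -- they vary differentiably.
  let k : V → Matrix (Fin d) (Fin d) ℂ := fun v => c⁻¹ • (η v * (γ v)ᴴ)
  have hk : HasFDerivAt k (c⁻¹ • mulDeriv (η v₀) (γ v₀)ᴴ η' (conjTransposeL d N ∘L γ')) v₀ :=
    (hη.matrix_mul hγ.matrix_conjTranspose).const_smul c⁻¹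
  set k' := c⁻¹ • mulDeriv (η v₀) (γ v₀)ᴴ η' (conjTransposeL d N ∘L γ') with hk'
  have hkU : ∀ᶠ v in 𝓝 v₀, (k v)ᴴ * k v = 1 ∧ η v = k v * γ v := by
    filter_upwards [hS, hU] with v h1 h2
    obtain ⟨A, hA⟩ := h2
    have h3 : k v = A := by
      change c⁻¹ • (η v * (γ v)ᴴ) = A
      rw [hA, smul_eq_mul_matrix, Matrix.mul_assoc, h1, Matrix.mul_smul, Matrix.mul_one, smul_smul,
        inv_mul_cancel₀ hc.ne', one_smul]
    rw [h3]
    exact ⟨unitary_conjTranspose_mul A, hA⟩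
  have h0 := hkU.self_of_nhds
  have h1 : ∀ v, (k v₀)ᴴ * k' v + (k' v)ᴴ * k v₀ = 0 := by
    intro v
    have h2 : HasFDerivAt (fun _ : V => (1 : Matrix (Fin d) (Fin d) ℂ))
      (0 : V →L[ℝ] Matrix (Fin d) (Fin d) ℂ) v₀ := hasFDerivAt_const _ _
    exact DFunLike.congr_fun ((hk.matrix_conjTranspose.matrix_mul hk).unique
      (h2.congr_of_eventuallyEq (hkU.mono fun v hv => hv.1))) v
  have h2 : ∀ v, η' v = k v₀ * γ' v + k' v * γ v₀ := fun v =>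
    DFunLike.congr_fun (hη.unique ((hk.matrix_mul hγ).congr_of_eventuallyEq
      (hkU.mono fun v hv => hv.2))) v
  -- Differentiating k*k = 1 makes k*k' skew-Hermitian; then η' = k(γ' + ξγ).
  let ξ : V → LieU d := fun v => ⟨(k v₀)ᴴ * k' v, by
    change _ᴴ = -_
    rw [Matrix.conjTranspose_mul, Matrix.conjTranspose_conjTranspose]
    exact eq_neg_of_add_eq_zero_right (h1 v)⟩
  have h3 : ∀ v, η' v = k v₀ * (γ' v + (ξ v : Matrix (Fin d) (Fin d) ℂ) * γ v₀) := by
    intro v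
    rw [h2 v, Matrix.mul_add]
    congr 1
    change k' v * γ v₀ = k v₀ * ((k v₀)ᴴ * k' v * γ v₀)
    rw [Matrix.mul_assoc, ← Matrix.mul_assoc (k v₀), mul_eq_one_comm.1 h0.1, Matrix.one_mul]
  rw [h3 v, h3 w, stdAlt_unitary_mul h0.1]
  exact stdAlt_add_lie_mul hS.self_of_nhds (ξ v) (ξ w) (gramDeriv_tangent hγ hS v)
    (gramDeriv_tangent hγ hS w)

theorem finrank_ker_gramDeriv (hc : 0 < c) {F : Matrix (Fin d) (Fin N) ℂ}
    (hF : F * Fᴴ = c • (1 : Matrix (Fin d) (Fin d) ℂ)) :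
    Module.finrank ℝ (LinearMap.ker (gramDeriv F).toLinearMap) = 2 * d * N - d ^ 2 := by
  have hs : Function.Surjective (fderiv ℝ (momentum d N) F) := by
    refine fderiv_momentum_surjective ?_
    rw [hF]
    exact isUnit_iff_ne_zero.2 (det_smul_one_ne_zero hc)
  have hk : LinearMap.ker (fderiv ℝ (momentum d N) F).toLinearMap =
      LinearMap.ker (gramDeriv F).toLinearMap := by
    ext T
    have h := fderiv_momentum_coe F T
    constructor
    · intro hT
      have hT' : fderiv ℝ (momentum d N) F T = 0 := hT
      have h2 := congrArg Subtype.val hT'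
      exact h.symm.trans h2
    · intro hT
      exact Subtype.ext (h.trans hT)
  have h := LinearMap.finrank_range_add_finrank_ker (fderiv ℝ (momentum d N) F).toLinearMap
  have hr : LinearMap.range (fderiv ℝ (momentum d N) F).toLinearMap = ⊤ :=
    LinearMap.range_eq_top.2 hs
  rw [hr, finrank_top, finrank_herm, finrank_matrix, hk] at h
  omega

section

variable (hc : 0 < c) (hdN : d ≤ N)

theorem gramDeriv_inclDeriv (p : tightFrames d N c) (v) :
    gramDeriv (p : Matrix (Fin d) (Fin N) ℂ) ((levelAtlas hc hdN).inclDeriv p v) = 0 := by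
  have h := gramDeriv_tangent ((levelAtlas hc hdN).hasFDerivAt_param p)
    (Eventually.of_forall fun v => (mem_tightFrames_iff hc).1 ((levelAtlas hc hdN).lift p v).2) v
  rwa [(levelAtlas hc hdN).param_base p] at h

/-- The tangent space lies in ker dΦ and has the same dimension 2dN - d², so the two agree. -/
theorem exists_inclDeriv_eq (p : tightFrames d N c) {T : Matrix (Fin d) (Fin N) ℂ}
    (hT : gramDeriv (p : Matrix (Fin d) (Fin N) ℂ) T = 0) :
    ∃ v, (levelAtlas hc hdN).inclDeriv p v = T := by
  have hle : LinearMap.range ((levelAtlas hc hdN).inclDeriv p).toLinearMap ≤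
      LinearMap.ker (gramDeriv (p : Matrix (Fin d) (Fin N) ℂ)).toLinearMap := by
    rintro _ ⟨v, rfl⟩
    exact gramDeriv_inclDeriv hc hdN p v
  have heq := Submodule.eq_of_le_of_finrank_eq hle (by
    rw [LinearMap.finrank_range_of_inj ((levelAtlas hc hdN).inclDeriv_injective p),
      finrank_ker_gramDeriv hc ((mem_tightFrames_iff hc).1 p.2), finrank_euclideanSpace_fin])
  have hm : T ∈ LinearMap.range ((levelAtlas hc hdN).inclDeriv p).toLinearMap := by
    rw [heq]; exact hT
  exact hm

theorem stdAlt_slideDeriv (p : tightFrames d N c) :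
    (stdAlt d N).compContinuousLinearMap ((levelAtlas hc hdN).slideDeriv (orbitAtlas d N hc) p) =
      (stdAlt d N).compContinuousLinearMap ((levelAtlas hc hdN).inclDeriv p) := by
  ext v
  refine stdAlt_deriv_eq hc ((levelAtlas hc hdN).hasFDerivAt_param p)
    ((levelAtlas hc hdN).hasFDerivAt_slide (orbitAtlas d N hc) p)
    (Eventually.of_forall fun v => (mem_tightFrames_iff hc).1 ((levelAtlas hc hdN).lift p v).2)
    ?_ (v 0) (v 1)
  filter_upwards [(levelAtlas hc hdN).eventually_proj_slide (orbitAtlas d N hc)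
    continuous_quotient_mk' p] with z hz
  exact orbitProj_eq_iff.1 hz

theorem coordDeriv_surjective (p : tightFrames d N c) : Function.Surjective
    ((fderiv ℝ ((orbitAtlas d N hc).coord (orbitProj (U d) (tightFrames d N c) p)) p) ∘L
      (levelAtlas hc hdN).inclDeriv p) := by
  set B := orbitAtlas d N hc
  set x := orbitProj (U d) (tightFrames d N c) p with hx
  have h : orbitProj (U d) (tightFrames d N c) p =
      orbitProj (U d) (tightFrames d N c) (B.lift x (B.base x)) := by
    rw [B.proj_lift x _ (B.base_mem x), SliceAtlas.base, (B.chart x).left_inv (B.mem_source x)]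
  -- The stored section meets the orbit of p but perhaps not at p; translating it by A makes it pass
  -- through p.
  obtain ⟨A, hA⟩ := orbitProj_eq_iff.1 h
  refine (levelAtlas hc hdN).coordDeriv_inclDeriv_surjective B p
    (f := fun w => ⟨A • (B.lift x w : Matrix (Fin d) (Fin N) ℂ),
      smul_mem_tightFrames hc A (B.lift x w).2⟩) ?_ (Subtype.ext hA.symm) ?_
  · have h1 := (B.contDiffAt_lift (B.base_mem x)).differentiableAt (by simp)
    exact (matMulL d d N (A : Matrix (Fin d) (Fin d) ℂ)).differentiableAt.comp _ h1
  · filter_upwards [(B.chart x).open_target.mem_nhds (B.base_mem x)] with w hw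
    rw [← B.proj_lift x w hw]
    exact orbitProj_eq_iff.2 ⟨A, rfl⟩

theorem coordDeriv_lie_mul (p : tightFrames d N c) (ξ : LieU d) :
    fderiv ℝ ((orbitAtlas d N hc).coord (orbitProj (U d) (tightFrames d N c) p)) p
      ((ξ : Matrix (Fin d) (Fin d) ℂ) * (p : Matrix (Fin d) (Fin N) ℂ)) = 0 := by
  set B := orbitAtlas d N hc
  set x := orbitProj (U d) (tightFrames d N c) p with hx
  set F := (p : Matrix (Fin d) (Fin N) ℂ) with hF
  -- The straight line (1 + tξ)F replaces the exponential. It may leave the tight frames, but the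
  -- coordinate is GL(d)-invariant and hence constant along it for small t.
  set a : ℝ → Matrix (Fin d) (Fin d) ℂ := fun t => 1 + t • (ξ : Matrix (Fin d) (Fin d) ℂ) with ha
  have ha0 : a 0 = 1 := by simp [ha]
  have hγ : HasDerivAt (fun t => F + t • ((ξ : Matrix (Fin d) (Fin d) ℂ) * F))
      ((ξ : Matrix (Fin d) (Fin d) ℂ) * F) (0 : ℝ) := by
    exact (((hasDerivAt_id (0 : ℝ)).smul_const
      ((ξ : Matrix (Fin d) (Fin d) ℂ) * F)).const_add F).congr_deriv (one_smul ℝ _)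
  have h1 : HasFDerivAt (B.coord x) (fderiv ℝ (B.coord x) F)
      (F + (0 : ℝ) • ((ξ : Matrix (Fin d) (Fin d) ℂ) * F)) := by
    rw [zero_smul, add_zero]; exact B.hasFDerivAt_coord p
  have h2 := h1.comp_hasDerivAt (0 : ℝ) hγ
  have hdet : ∀ᶠ t in 𝓝 (0 : ℝ), (a t).det ≠ 0 := by
    refine eventually_det_ne_zero (Continuous.continuousAt ?_) (by rw [ha0]; simp)
    exact continuous_const.add (continuous_id.smul continuous_const)
  refine h2.unique ((hasDerivAt_const (0 : ℝ) (B.coord x F)).congr_of_eventuallyEq ?_)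
  filter_upwards [hdet] with t ht
  have h3 : F + t • ((ξ : Matrix (Fin d) (Fin d) ℂ) * F) = a t * F := by
    rw [ha, Matrix.add_mul, Matrix.one_mul, Matrix.smul_mul]
  rw [Function.comp_apply, h3]
  exact congrArg (horizontalParam hc x.out).proj (affineCoord_left_mul ht)

/-- The kernel of the form on a level set consists of the tangent spaces of the orbits. -/
theorem exists_lie_mul_eq {F T : Matrix (Fin d) (Fin N) ℂ} (hc : 0 < c)
    (hF : F * Fᴴ = c • (1 : Matrix (Fin d) (Fin d) ℂ)) (hT : gramDeriv F T = 0)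
    (h : ∀ Y, gramDeriv F Y = 0 → stdAlt d N ![T, Y] = 0) :
    ∃ ξ : LieU d, T = (ξ : Matrix (Fin d) (Fin d) ℂ) * F := by
  have hT' : F * Tᴴ + T * Fᴴ = 0 := neg_eq_zero.1 hT
  -- This choice makes Z = T - ξF satisfy ZF* = 0; tangency of T makes it skew-Hermitian.
  let ξ : LieU d := ⟨c⁻¹ • (T * Fᴴ), by
    change _ᴴ = -_
    rw [Matrix.conjTranspose_smul, Matrix.conjTranspose_mul, Matrix.conjTranspose_conjTranspose,
      star_trivial, ← smul_neg, eq_neg_of_add_eq_zero_left hT']⟩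
  set Z := T - (ξ : Matrix (Fin d) (Fin d) ℂ) * F with hZ
  have hZF : Z * Fᴴ = 0 := by
    rw [hZ, Matrix.sub_mul, Matrix.mul_assoc, hF]
    change T * Fᴴ - c⁻¹ • (T * Fᴴ) * c • (1 : Matrix (Fin d) (Fin d) ℂ) = 0
    rw [Matrix.smul_mul, Matrix.mul_smul, Matrix.mul_one, smul_smul, inv_mul_cancel₀ hc.ne',
      one_smul, sub_self]
  have hFZ : F * Zᴴ = 0 := by
    have := congrArg Matrix.conjTranspose hZF
    rwa [Matrix.conjTranspose_mul, Matrix.conjTranspose_conjTranspose,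
      Matrix.conjTranspose_zero] at this
  -- The condition ZF* = 0 is complex linear, so iZ is also tangent and can be used as a test
  -- vector.
  have hIZ : gramDeriv F (Complex.I • Z) = 0 := by
    rw [gramDeriv_apply, Matrix.conjTranspose_smul, Matrix.mul_smul, Matrix.smul_mul, hZF, hFZ]
    simp
  have hTZ : T = Z + (ξ : Matrix (Fin d) (Fin d) ℂ) * F := by rw [hZ]; abel
  have h1 := h _ hIZ
  rw [hTZ, stdAlt_add_left, stdAlt_lie_mul_eq_zero ξ hIZ, add_zero] at h1
  refine ⟨ξ, ?_⟩
  rw [hTZ, eq_zero_of_stdAlt_I_smul h1, zero_add]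

theorem coordDeriv_eq_zero (p : tightFrames d N c) (v)
    (h : ∀ v', stdAlt d N ![(levelAtlas hc hdN).inclDeriv p v,
      (levelAtlas hc hdN).inclDeriv p v'] = 0) :
    fderiv ℝ ((orbitAtlas d N hc).coord (orbitProj (U d) (tightFrames d N c) p)) p
      ((levelAtlas hc hdN).inclDeriv p v) = 0 := by
  obtain ⟨ξ, hξ⟩ := exists_lie_mul_eq hc ((mem_tightFrames_iff hc).1 p.2)
    (gramDeriv_inclDeriv hc hdN p v) (fun Y hY => by
      obtain ⟨v', rfl⟩ := exists_inclDeriv_eq hc hdN p hY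
      exact h v')
  rw [hξ]
  exact coordDeriv_lie_mul hc p ξ

theorem hasReducedSymplecticForm_tightFrames (hc : 0 < c) (hdN : d ≤ N) :
    HasReducedSymplecticForm (U d) (tightFrames d N c) (stdForm d N)
      (2 * d * N - d ^ 2) (2 * (d * N - d ^ 2)) :=
  hasReducedSymplecticForm_of_sliceAtlas (levelAtlas hc hdN) (orbitAtlas d N hc)
    (t2Space_orbitSpace hc) (secondCountableTopology_orbitSpace hc) (stdAlt d N)
    (stdAlt_slideDeriv hc hdN) (coordDeriv_surjective hc hdN) (coordDeriv_eq_zero hc hdN)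

end

end Reduction

end FrameReduction

/-! ### The main theorem. -/

open FrameReduction
theorem mainTheorem6 (d N : ℕ) (hd : 0 < d) (hdN : d ≤ N) :
    -- the standard form is symplectic, and `α` identifies `H(d)` with `u(d)*`
    IsSymplecticForm (stdForm d N) ∧
    Function.Bijective (alpha d) ∧
    -- the action of `U(d)` is Hamiltonian with momentum map `F ↦ -F F*`
    IsMomentumMap (stdForm d N) (fun F => alpha d (momentum d N F)) ∧
    -- its regular values are exactly the negative definite matrices
    (∀ χ : Herm d, IsRegularValue (momentum d N) χ ↔
      (-(χ : Matrix (Fin d) (Fin d) ℂ)).PosDef) ∧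
    -- the space of `N/d`-tight frames is the level set over `-(N/d) I`
    tightFrames d N ((N : ℝ) / d) =
      {F | (momentum d N F : Matrix (Fin d) (Fin d) ℂ) = -(((N : ℝ) / d) • 1)} ∧
    -- `U(d)` acts on it, freely
    (∀ (A : U d), ∀ F ∈ tightFrames d N ((N : ℝ) / d),
      A • F ∈ tightFrames d N ((N : ℝ) / d)) ∧
    (∀ (A : U d), ∀ F ∈ tightFrames d N ((N : ℝ) / d), A • F = F → A = 1) ∧
    -- the quotient is a smooth manifold with a unique reduced symplectic form
    HasReducedSymplecticForm (U d) (tightFrames d N ((N : ℝ) / d)) (stdForm d N)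
      (2 * d * N - d ^ 2) (2 * (d * N - d ^ 2)) := by
  -- The level-set results hold for every c > 0; N/d is positive because 0 < d ≤ N.
  have hc : 0 < (N : ℝ) / d :=
    div_pos (Nat.cast_pos.2 (hd.trans_le hdN)) (Nat.cast_pos.2 hd)
  exact ⟨isSymplecticForm_stdForm d N, alpha_bijective d, isMomentumMap_momentum d N,
    isRegularValue_momentum_iff hdN, tightFrames_eq_level hc,
    fun A _ hF => smul_mem_tightFrames hc A hF, fun A _ hF h => eq_one_of_smul_eq hc A hF h,
    hasReducedSymplecticForm_tightFrames hc hdN⟩
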